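/- Let $\mathbb{N}_0=\{0,1,2,\dots\}$. Let $(X_n)_{n\in\mathbb{N}_0}$ be a (strictly) stationary sequence of real random variables with marginal distribution $F$, and let $$\alpha(m)=\sup_{k\in\mathbb{N}_0}\ \sup\bigl\{|P(A\cap B)-P(A)P(B)| : A\in\sigma(X_0,\dots,X_k),\ B\in\sigma(X_j: j\ge k+m)\bigr\},\qquad m\in\mathbb{N}_0,$$ be its strong mixing coefficients. Let $h:\mathbb{R}^2\to\mathbb{R}$ be a symmetric measurable kernel, and put $$\theta=\iint h\,dF\,dF,\qquad h_1(x)=\int h(x,y)\,dF(y)-\theta,\qquad h_2(x,y)=h(x,y)-h_1(x)-h_1(y)-\theta .$$ Let $\gamma,\delta,M,L>0$ and assume: 1. $h$ is $\mathcal{P}$-Lipschitz-continuous with constant $L$, that is, $$E\bigl[|h(X,Y)-h(X',Y)|\,\mathbf 1_{\{|X-X'|\le\epsilon\}}\bigr]\le L\epsilon$$ for every $\epsilon>0$ and all real random variables $X,X',Y$ on a common probability space such that each of the pairs $(X,Y)$ and $(X',Y)$ has as its distribution either the distribution of $(X_0,X_k)$ for some $k\in\mathbb{N}_0$ or $F\times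 F$ (the two pairs may have different distributions); 2. $E|X_0|^\gamma<\infty$, and $\|X_0\|_\gamma:=(E|X_0|^\gamma)^{1/\gamma}$; 3. $\displaystyle\iint|h(x,y)|^{2+\delta}\,dF(x)\,dF(y)\le M$, and $E|h(X_0,X_k)|^{2+\delta}\le M$ for all $k\in\mathbb{N}_0$. Then there is a constant $K$ depending only on $\gamma,\|X_0\|_\gamma,\delta,M,L$ such that for all $i_1,i_2,i_3,i_4\in\mathbb{N}_0$ the product $h_2(X_{i_1},X_{i_2})\,h_2(X_{i_3},X_{i_4})$ is integrable and $$\bigl|E\bigl[h_2(X_{i_1},X_{i_2})\,h_2(X_{i_3},X_{i_4})\bigr]\bigr|\le K\,\alpha(m)^{\frac{2\gamma\delta}{3\gamma\delta+\delta+5\gamma+2}},$$ where $m=\max\{i_{(2)}-i_{(1)},\,i_{(4)}-i_{(3)}\}$ and $i_{(1)}\le i_{(2)}\le i_{(3)}\le i_{(4)}$ are the indices in increasing order. -/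

import Mathlib

open MeasureTheory ProbabilityTheory

noncomputable section

namespace UStat

variable {Ω : Type*} [MeasurableSpace Ω]

/-- Strict stationarity of a real sequence indexed by `0, 1, 2, …`: the law of the whole sequence
is invariant under shifts of the index. -/
def IsStationary (X : ℕ → Ω → ℝ) (μ : Measure Ω) : Prop :=
  ∀ s : ℕ, μ.map (fun ω (n : ℕ) => X (n + s) ω) = μ.map (fun ω (n : ℕ) => X n ω)

/-- The strong mixing coefficient of two σ-algebras:
the supremum of `|P(A ∩ B) - P(A) P(B)|` over `A ∈ 𝓐`, `B ∈ 𝓑`. -/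
def alphaCoeff (μ : Measure Ω) (𝓐 𝓑 : MeasurableSpace Ω) : ℝ :=
  sSup {r : ℝ | ∃ A B : Set Ω, MeasurableSet[𝓐] A ∧ MeasurableSet[𝓑] B ∧
    r = |μ.real (A ∩ B) - μ.real A * μ.real B|}

/-- The σ-algebra generated by the variables `X i` with `i ∈ I`. -/
abbrev sigmaGen (X : ℕ → Ω → ℝ) (I : Set ℕ) : MeasurableSpace Ω :=
  ⨆ i ∈ I, MeasurableSpace.comap (X i) inferInstance

/-- The strong mixing coefficients `α(m)` of a sequence: the supremum over `k` of the mixing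
coefficient of `(X 0, …, X k)` and `(X j)_{j ≥ k + m}`. -/
def alphaMix (X : ℕ → Ω → ℝ) (μ : Measure Ω) (m : ℕ) : ℝ :=
  ⨆ k : ℕ, alphaCoeff μ (sigmaGen X (Set.Iic k)) (sigmaGen X (Set.Ici (k + m)))

/-- The admissible joint laws of a pair: the law of `(X 0, X k)` for some `k ≥ 0`, or the product
of the marginal law with itself. -/
def pairLaws (X : ℕ → Ω → ℝ) (μ : Measure Ω) : Set (Measure (ℝ × ℝ)) :=
  {P | P = (μ.map (X 0)).prod (μ.map (X 0)) ∨ ∃ k : ℕ, P = μ.map (fun ω => (X 0 ω, X k ω))}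

/-- `𝒫`-Lipschitz continuity with constant `L > 0`. A triple `(x, x', y)` of random variables is
represented by its joint law `ν` on `ℝ × ℝ × ℝ`; the laws of `(x, y)` and of `(x', y)` are
required to be admissible. -/
def IsPLipschitz (X : ℕ → Ω → ℝ) (μ : Measure Ω) (h : ℝ → ℝ → ℝ) (L : ℝ) : Prop :=
  0 < L ∧ ∀ ε : ℝ, 0 < ε → ∀ ν : Measure (ℝ × ℝ × ℝ),
    ν.map (fun p => (p.1, p.2.2)) ∈ pairLaws X μ →
    ν.map (fun p => (p.2.1, p.2.2)) ∈ pairLaws X μ →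
    ∫⁻ p in {p : ℝ × ℝ × ℝ | |p.1 - p.2.1| ≤ ε},
      ENNReal.ofReal |h p.1 p.2.2 - h p.2.1 p.2.2| ∂ν ≤ ENNReal.ofReal (L * ε)

/-- `θ = ∫∫ h(x, y) dF(x) dF(y)`. -/
def theta (F : Measure ℝ) (h : ℝ → ℝ → ℝ) : ℝ :=
  ∫ p : ℝ × ℝ, h p.1 p.2 ∂(F.prod F)

/-- The linear part of the Hoeffding decomposition, `h₁(x) = ∫ h(x, y) dF(y) - θ`. -/
def hoeff1 (F : Measure ℝ) (h : ℝ → ℝ → ℝ) (x : ℝ) : ℝ :=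
  (∫ y, h x y ∂F) - theta F h

/-- The degenerate part of the Hoeffding decomposition,
`h₂(x, y) = h(x, y) - h₁(x) - h₁(y) - θ`. -/
def hoeff2 (F : Measure ℝ) (h : ℝ → ℝ → ℝ) (x y : ℝ) : ℝ :=
  h x y - hoeff1 F h x - hoeff1 F h y - theta F h

/-- For four indices with increasing rearrangement `j 0 ≤ j 1 ≤ j 2 ≤ j 3`, the larger of the two
outer gaps `j 1 - j 0` and `j 3 - j 2`. -/
def outerGap (i : Fin 4 → ℕ) : ℕ :=
  max ((i ∘ Tuple.sort i) 1 - (i ∘ Tuple.sort i) 0) ((i ∘ Tuple.sort i) 3 - (i ∘ Tuple.sort i) 2)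

end UStat

end

noncomputable section

namespace UStat

/-! The larger outer gap separates one extreme variable `V` from the three others
(`exists_separated_index`). By symmetry of `hoeff2` the product is `hoeff2 F h V Y * G`, where `Y`
and `G` are measurable for a σ-algebra `m` whose mixing coefficient with `V` is at most `α`. If `V`
were independent of `(Y, G)`, the expectation would vanish, since `hoeff2` integrates to zero in one
variable. So `V` is replaced by a nearby copy `v` with law `F`, independent of `(Y, G)`, and the
error is estimated (`abs_integral_hoeff2_mul_le`).

The copy comes from a coupling on cells of length `ε`. On each cell one keeps the minimum of the
conditional probability given `m` and the unconditional one. The lost mass is at most the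
probability of lying outside the `n` chosen cells plus the integrated total variation distance over
these cells. The latter is of order `√n * α`: each signed sum of the deviations has `L¹` norm
`O(α)`, and Khintchine's inequality passes from the average over signs to the sum of absolute values
(`sum_integral_abs_condProb_sub_le`). Only the mass on which the copies are close is constructed, as
a measure of mass below one. It extends to a genuine coupling when the Lipschitz hypothesis is
invoked (`exists_extension_of_subcoupling`).

That hypothesis treats pairs in time order only. When `V` comes after `Y`, the law of `(V, Y)` need
not be admissible, so a copy `y` of `Y` is introduced as well, and `V` is replaced in three
admissible moves (`exists_double_subcoupling`).

The lost mass is handled by the moment of order `1 + δ / 2` of the product with truncation level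
`A`, the retained mass by the Lipschitz bound with truncation of `G` at `K`. With a scale `b`, the
choices `ε = b ^ (1 + δ)`, `K = b⁻¹`, `A = b⁻²` and lost mass of order `b ^ (2 + δ)` make every
error of order `b ^ δ`. Balancing the tail of `F` against `√n * α` then links `b` to `α` and
produces the exponent. -/

/-! ### Khintchine's inequality for averages over signs. -/

lemma sum_powerset_signed_sq {ι : Type*} [DecidableEq ι] (b : ι → ℝ) (J : Finset ι) :
    ∑ T ∈ J.powerset, (2 * ∑ j ∈ T, b j - ∑ j ∈ J, b j) ^ 2 = 2 ^ J.card * ∑ j ∈ J, b j ^ 2 := by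
  induction J using Finset.induction_on with
  | empty => simp
  | insert a s ha ih =>
    have h1 : ∑ T ∈ (insert a s).powerset,
        (2 * ∑ j ∈ T, b j - ∑ j ∈ insert a s, b j) ^ 2 =
        2 * ∑ T ∈ s.powerset, (2 * ∑ j ∈ T, b j - ∑ j ∈ s, b j) ^ 2
        + 2 * b a ^ 2 * 2 ^ s.card := by
      have h3 : (2 * b a ^ 2 * 2 ^ s.card) = ∑ T ∈ s.powerset, 2 * b a ^ 2 := by
        rw [Finset.sum_const, nsmul_eq_mul]; simp; ring
      rw [Finset.sum_powerset_insert ha, Finset.sum_insert ha, h3, Finset.mul_sum,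
        ← Finset.sum_add_distrib, ← Finset.sum_add_distrib]
      refine Finset.sum_congr rfl fun T hT => ?_
      rw [Finset.sum_insert (fun h => ha (Finset.mem_powerset.1 hT h))]
      ring
    rw [h1, ih, Finset.card_insert_of_notMem ha, Finset.sum_insert ha]
    ring

/-- A subset `T` records which signs are positive. Adding `± b a` to a signed sum `t` yields `2 t⁴ +
12 b_a² t² + 2 b_a⁴`, the odd terms cancelling, and the second moment is known exactly. -/
lemma sum_powerset_signed_pow_four_le {ι : Type*} [DecidableEq ι] (b : ι → ℝ) (J : Finset ι) :
    ∑ T ∈ J.powerset, (2 * ∑ j ∈ T, b j - ∑ j ∈ J, b j) ^ 4 ≤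
      2 ^ J.card * (3 * (∑ j ∈ J, b j ^ 2) ^ 2) := by
  induction J using Finset.induction_on with
  | empty => simp
  | insert a s ha ih =>
    have h1 : ∑ T ∈ (insert a s).powerset,
        (2 * ∑ j ∈ T, b j - ∑ j ∈ insert a s, b j) ^ 4 =
        2 * ∑ T ∈ s.powerset, (2 * ∑ j ∈ T, b j - ∑ j ∈ s, b j) ^ 4
        + 12 * b a ^ 2 * ∑ T ∈ s.powerset, (2 * ∑ j ∈ T, b j - ∑ j ∈ s, b j) ^ 2
        + 2 * b a ^ 4 * 2 ^ s.card := by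
      have h3 : (2 * b a ^ 4 * 2 ^ s.card) = ∑ T ∈ s.powerset, 2 * b a ^ 4 := by
        rw [Finset.sum_const, nsmul_eq_mul]; simp; ring
      rw [Finset.sum_powerset_insert ha, Finset.sum_insert ha, h3, Finset.mul_sum, Finset.mul_sum,
        ← Finset.sum_add_distrib, ← Finset.sum_add_distrib, ← Finset.sum_add_distrib]
      refine Finset.sum_congr rfl fun T hT => ?_
      rw [Finset.sum_insert (fun h => ha (Finset.mem_powerset.1 hT h))]
      ring
    rw [h1, sum_powerset_signed_sq, Finset.card_insert_of_notMem ha, Finset.sum_insert ha]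
    have h4 : (0 : ℝ) ≤ 2 ^ s.card * b a ^ 4 := by positivity
    rw [pow_succ 2 s.card]
    nlinarith

/-- Khintchine's inequality in `L¹`, in averaged form over all choices of signs. -/
lemma sqrt_sum_sq_le_sum_powerset {ι : Type*} [DecidableEq ι] (b : ι → ℝ) (J : Finset ι) :
    2 ^ J.card * (9 / 16 * √(∑ j ∈ J, b j ^ 2)) ≤
      ∑ T ∈ J.powerset, |2 * ∑ j ∈ T, b j - ∑ j ∈ J, b j| := by
  set σ := √(∑ j ∈ J, b j ^ 2) with hσ
  have hσ2 : σ ^ 2 = ∑ j ∈ J, b j ^ 2 := Real.sq_sqrt (Finset.sum_nonneg fun _ _ => sq_nonneg _)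
  rcases (Real.sqrt_nonneg _ : 0 ≤ σ).eq_or_lt with h0 | hpos
  · rw [← hσ] at h0; rw [← h0]; simp only [mul_zero]; exact Finset.sum_nonneg fun _ _ => abs_nonneg _
  -- A lower bound for `|t|` by second and fourth powers, tangent at `|t| = 2σ`. Averaged with
  -- second moment `σ²` and fourth moment at most `3σ⁴`, it leaves `3/4 - 3/16 = 9/16`.
  have key : ∀ t : ℝ, 3 / 4 * t ^ 2 * σ ^ 2 - t ^ 4 / 16 ≤ |t| * σ ^ 3 := by
    intro t
    rw [← sq_abs t, show t ^ 4 = |t| ^ 4 by rw [show 4 = 2 * 2 from rfl, pow_mul, pow_mul, sq_abs]]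
    set u := |t|
    have hu : 0 ≤ u := abs_nonneg t
    have : 0 ≤ u * ((u - 2 * σ) ^ 2 * (u + 4 * σ)) := by positivity
    nlinarith
  have hs : ∑ T ∈ J.powerset, (3 / 4 * (2 * ∑ j ∈ T, b j - ∑ j ∈ J, b j) ^ 2 * σ ^ 2
      - (2 * ∑ j ∈ T, b j - ∑ j ∈ J, b j) ^ 4 / 16) ≤
      ∑ T ∈ J.powerset, |2 * ∑ j ∈ T, b j - ∑ j ∈ J, b j| * σ ^ 3 :=
    Finset.sum_le_sum fun T _ => key _
  rw [Finset.sum_sub_distrib, ← Finset.sum_mul, ← Finset.mul_sum, ← Finset.sum_div,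
    ← Finset.sum_mul, sum_powerset_signed_sq, ← hσ2] at hs
  have h4 := sum_powerset_signed_pow_four_le b J
  rw [← hσ2] at h4
  have : (2 ^ J.card * (9 / 16 * σ)) * σ ^ 3 ≤
      (∑ T ∈ J.powerset, |2 * ∑ j ∈ T, b j - ∑ j ∈ J, b j|) * σ ^ 3 := by nlinarith
  exact le_of_mul_le_mul_right this (by positivity)

/-- Cauchy–Schwarz followed by Khintchine. This is where the number of cells enters through its
square root only. -/
lemma sum_abs_le_sum_powerset {ι : Type*} [DecidableEq ι] (b : ι → ℝ) (J : Finset ι) :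
    2 ^ J.card * ∑ j ∈ J, |b j| ≤
      16 / 9 * √J.card * ∑ T ∈ J.powerset, |2 * ∑ j ∈ T, b j - ∑ j ∈ J, b j| := by
  have h1 : ∑ j ∈ J, |b j| ≤ √J.card * √(∑ j ∈ J, b j ^ 2) := by
    rw [← Real.sqrt_mul (Nat.cast_nonneg _)]
    refine Real.le_sqrt_of_sq_le ?_
    have := sq_sum_le_card_mul_sum_sq (s := J) (f := fun j => |b j|)
    simpa using this
  have h2 := sqrt_sum_sq_le_sum_powerset b J
  calc 2 ^ J.card * ∑ j ∈ J, |b j| ≤ 2 ^ J.card * (√J.card * √(∑ j ∈ J, b j ^ 2)) := by gcongr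
    _ = 16 / 9 * √J.card * (2 ^ J.card * (9 / 16 * √(∑ j ∈ J, b j ^ 2))) := by ring
    _ ≤ _ := by gcongr

/-! ### Conditional probabilities and total variation under strong mixing. -/

/-- A version of the conditional probability of `E` given `m`, with values in `[0, 1]`. -/
lemma exists_condProb {Ω : Type*} {m : MeasurableSpace Ω} [mΩ : MeasurableSpace Ω] (hm : m ≤ mΩ)
    (μ : Measure Ω) [IsProbabilityMeasure μ] {E : Set Ω} (hE : MeasurableSet E) :
    ∃ q : Ω → ℝ, Measurable[m] q ∧ (∀ ω, 0 ≤ q ω) ∧ (∀ ω, q ω ≤ 1) ∧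
      (∀ B, MeasurableSet[m] B → ∫ ω in B, q ω ∂μ = μ.real (E ∩ B)) ∧
      ∀ f : Ω → ENNReal, Measurable[m] f →
        ∫⁻ ω in E, f ω ∂μ = ∫⁻ ω, ENNReal.ofReal (q ω) * f ω ∂μ := by
  have hint : Integrable (E.indicator fun _ => (1 : ℝ)) μ := (integrable_const 1).indicator hE
  set q0 := μ[E.indicator fun _ => (1 : ℝ)|m] with hq0
  have hq0m : Measurable[m] q0 := stronglyMeasurable_condExp.measurable
  -- Clipping the conditional expectation changes it on a null set only and makes the bounds hold at
  -- every point.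
  have hae : ∀ᵐ ω ∂μ, max 0 (min 1 (q0 ω)) = q0 ω := by
    have h1 : 0 ≤ᵐ[μ] q0 := condExp_nonneg (ae_of_all _ fun ω => by
      by_cases h : ω ∈ E <;> simp [h])
    have h2 : q0 ≤ᵐ[μ] μ[fun _ => (1 : ℝ)|m] := condExp_mono hint (integrable_const 1)
      (ae_of_all _ fun ω => by by_cases h : ω ∈ E <;> simp [h])
    rw [condExp_const hm] at h2
    filter_upwards [h1, h2] with ω a b
    simp at a b
    rw [min_eq_right b, max_eq_right a]
  have hset : ∀ B, MeasurableSet[m] B →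
      ∫ ω in B, max 0 (min 1 (q0 ω)) ∂μ = μ.real (E ∩ B) := by
    intro B hB
    rw [setIntegral_congr_ae (g := q0) (hm _ hB) (hae.mono fun _ h _ => h), hq0,
      setIntegral_condExp hm hint hB, setIntegral_indicator hE]
    simp [Set.inter_comm]
  have hqm : Measurable[m] fun ω => max 0 (min 1 (q0 ω)) :=
    measurable_const.max (measurable_const.min hq0m)
  refine ⟨fun ω => max 0 (min 1 (q0 ω)), hqm, fun ω => le_max_left _ _,
    fun ω => max_le zero_le_one (min_le_left _ _), hset, ?_⟩
  -- The identity on sets of `m` says that `q` is the density of `μ.restrict E` on `m`; integrals of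
  -- all `m`-measurable functions follow.
  have hmeas : (μ.restrict E).trim hm =
      (μ.trim hm).withDensity (fun ω => ENNReal.ofReal (max 0 (min 1 (q0 ω)))) := by
    refine @Measure.ext _ m _ _ fun B hB => ?_
    rw [trim_measurableSet_eq hm hB, withDensity_apply _ hB, Measure.restrict_apply (hm _ hB),
      restrict_trim hm μ hB, lintegral_trim hm hqm.ennreal_ofReal,
      ← ofReal_integral_eq_lintegral_ofReal, hset B hB, Measure.real,
      ENNReal.ofReal_toReal (measure_ne_top _ _), Set.inter_comm]
    · refine Integrable.of_bound (C := 1) (hqm.mono hm le_rfl).aestronglyMeasurable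
        (ae_of_all _ fun ω => ?_)
      rw [Real.norm_eq_abs, abs_of_nonneg (le_max_left _ _)]
      exact max_le zero_le_one (min_le_left _ _)
    · exact ae_of_all _ fun ω => le_max_left _ _
  intro f hf
  rw [← lintegral_trim hm hf, hmeas,
    lintegral_withDensity_eq_lintegral_mul _ hqm.ennreal_ofReal hf,
    lintegral_trim hm (hqm.ennreal_ofReal.mul hf)]
  rfl

/-- The integrated total variation distance between the conditional and the unconditional law of a
discrete variable with `N` relevant values is at most a multiple of `√N` times the strong mixing
coefficient. -/
lemma sum_integral_abs_condProb_sub_le {Ω ι : Type*} [DecidableEq ι] {m : MeasurableSpace Ω}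
    [mΩ : MeasurableSpace Ω]
    (hm : m ≤ mΩ) (μ : Measure Ω) [IsProbabilityMeasure μ] (E : ι → Set Ω) (J : Finset ι)
    (hE : ∀ j, MeasurableSet (E j)) (hdisj : Pairwise (Function.onFun Disjoint E)) {a : ℝ}
    (ha : ∀ T : Finset ι, ∀ B, MeasurableSet[m] B →
      |μ.real ((⋃ j ∈ T, E j) ∩ B) - μ.real (⋃ j ∈ T, E j) * μ.real B| ≤ a)
    (q : ι → Ω → ℝ) (hqm : ∀ j, Measurable[m] (q j)) (hq0 : ∀ j ω, 0 ≤ q j ω)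
    (hq1 : ∀ j ω, q j ω ≤ 1)
    (hqB : ∀ j B, MeasurableSet[m] B → ∫ ω in B, q j ω ∂μ = μ.real (E j ∩ B)) :
    ∑ j ∈ J, ∫ ω, |q j ω - μ.real (E j)| ∂μ ≤ 32 / 3 * √J.card * a := by
  set b : ι → Ω → ℝ := fun j ω => q j ω - μ.real (E j) with hb
  have hbi : ∀ j, Integrable (b j) μ := fun j => by
    refine Integrable.sub ?_ (integrable_const _)
    refine Integrable.of_bound (C := 1) ((hqm j).mono hm le_rfl).aestronglyMeasurable
        (ae_of_all _ fun ω => ?_)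
    rw [Real.norm_eq_abs, abs_of_nonneg (hq0 j ω)]
    exact hq1 j ω
  have hbm : ∀ j, Measurable[m] (b j) := fun j => (hqm j).sub_const _
  have hTB : ∀ T : Finset ι, ∀ B, MeasurableSet[m] B → |∫ ω in B, ∑ j ∈ T, b j ω ∂μ| ≤ a := by
    intro T B hB
    convert ha T B hB using 2
    rw [integral_finsetSum _ fun j _ => (hbi j).integrableOn, Set.iUnion₂_inter,
      measureReal_biUnion_finset (fun i _ j _ hij => (hdisj hij).mono Set.inter_subset_left Set.inter_subset_left)
        (fun j _ => (hE j).inter (hm _ hB)),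
      measureReal_biUnion_finset (fun i _ j _ hij => hdisj hij) (fun j _ => hE j), Finset.sum_mul,
      ← Finset.sum_sub_distrib]
    refine Finset.sum_congr rfl fun j _ => ?_
    rw [integral_sub, hqB j B hB]
    · simp [mul_comm]
    · refine Integrable.of_bound (C := 1) ((hqm j).mono hm le_rfl).aestronglyMeasurable
        (ae_of_all _ fun ω => ?_)
      rw [Real.norm_eq_abs, abs_of_nonneg (hq0 j ω)]
      exact hq1 j ω
    · exact integrable_const _
  have hTi : ∀ T : Finset ι, Integrable (fun ω => ∑ j ∈ T, b j ω) μ := fun T =>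
    integrable_finsetSum _ fun j _ => hbi j
  -- A signed sum is twice a sum over `T` minus a sum over `J`, so its integral over any set of `m`
  -- is at most `2a + a`. Splitting at its sign gives `6a`, and `16/9 * 6 = 32/3`.
  have hsign : ∀ T : Finset ι, ∫ ω, |2 * ∑ j ∈ T, b j ω - ∑ j ∈ J, b j ω| ∂μ ≤ 6 * a := by
    intro T
    set S : Ω → ℝ := fun ω => 2 * ∑ j ∈ T, b j ω - ∑ j ∈ J, b j ω with hS
    have hSi : Integrable S μ := ((hTi T).const_mul 2).sub (hTi J)
    have hsum : ∀ T : Finset ι, Measurable[m] fun ω => ∑ j ∈ T, b j ω := fun T =>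
      Finset.measurable_sum _ fun j _ => hbm j
    have hSm : Measurable[m] S := ((hsum T).const_mul 2).sub (hsum J)
    have hB : MeasurableSet[m] {ω | 0 ≤ S ω} := measurableSet_le measurable_const hSm
    have hsub : ∀ B, MeasurableSet[m] B → |∫ ω in B, S ω ∂μ| ≤ 3 * a := by
      intro B hB
      rw [hS, integral_sub ((hTi T).const_mul 2).integrableOn (hTi J).integrableOn,
        integral_const_mul]
      have h1 := abs_le.1 (hTB T B hB)
      have h2 := abs_le.1 (hTB J B hB)
      exact abs_le.2 ⟨by linarith, by linarith⟩
    rw [← integral_add_compl (hm _ hB) hSi.abs,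
      setIntegral_congr_fun (g := S) (hm _ hB) fun ω hω => abs_of_nonneg hω,
      setIntegral_congr_fun (g := fun ω => - S ω) (hm _ hB.compl)
        fun ω hω => abs_of_neg (not_le.1 hω), integral_neg]
    have h1 := abs_le.1 (hsub _ hB)
    have h2 := abs_le.1 (hsub _ hB.compl)
    linarith
  have hpt : ∫ ω, 2 ^ J.card * ∑ j ∈ J, |b j ω| ∂μ ≤ ∫ ω, 16 / 9 * √J.card *
      ∑ T ∈ J.powerset, |2 * ∑ j ∈ T, b j ω - ∑ j ∈ J, b j ω| ∂μ := by
    refine integral_mono ((integrable_finsetSum _ fun j _ => (hbi j).abs).const_mul _)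
      ((integrable_finsetSum _ fun T _ =>
        (((hTi T).const_mul 2).sub (hTi J)).abs).const_mul _) fun ω => ?_
    exact sum_abs_le_sum_powerset (fun j => b j ω) J
  rw [integral_const_mul, integral_const_mul, integral_finsetSum _ fun j _ => (hbi j).abs,
    integral_finsetSum (f := fun T ω => |2 * ∑ j ∈ T, b j ω - ∑ j ∈ J, b j ω|) _
      fun T _ => (((hTi T).const_mul 2).sub (hTi J)).abs] at hpt
  have hle : ∑ T ∈ J.powerset, ∫ ω, |2 * ∑ j ∈ T, b j ω - ∑ j ∈ J, b j ω| ∂μ ≤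
      2 ^ J.card * (6 * a) := by
    refine (Finset.sum_le_sum fun T _ => hsign T).trans_eq ?_
    simp
  have h2 : (0 : ℝ) < 2 ^ J.card := by positivity
  refine le_of_mul_le_mul_left (hpt.trans ?_) h2
  calc _ ≤ 16 / 9 * √J.card * (2 ^ J.card * (6 * a)) := by gcongr
    _ = _ := by ring

/-! ### Gluing and extension of sub-couplings. -/

/-- Two finite measures on `ℝ × ℝ` with the same second marginal can be glued along it. -/
lemma exists_gluing (R₁ R₂ : Measure (ℝ × ℝ)) [IsFiniteMeasure R₁] [IsFiniteMeasure R₂]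
    (h : R₁.map Prod.snd = R₂.map Prod.snd) :
    ∃ ν : Measure (ℝ × ℝ × ℝ), ν.map (fun p => (p.1, p.2.2)) = R₁ ∧
      ν.map (fun p => (p.2.1, p.2.2)) = R₂ := by
  have hfst : ∀ R : Measure (ℝ × ℝ), (R.map Prod.swap).fst = R.map Prod.snd := fun R => by
    rw [Measure.fst_map_swap, Measure.snd]
  set l := R₁.map Prod.snd with hl
  have h1 : l ⊗ₘ (R₁.map Prod.swap).condKernel = R₁.map Prod.swap := by
    rw [hl, ← hfst]; exact (R₁.map Prod.swap).disintegrate _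
  have h2 : l ⊗ₘ (R₂.map Prod.swap).condKernel = R₂.map Prod.swap := by
    rw [h, ← hfst]; exact (R₂.map Prod.swap).disintegrate _
  set κ₁ := (R₁.map Prod.swap).condKernel
  set κ₂ := (R₂.map Prod.swap).condKernel
  have hsw : ∀ R : Measure (ℝ × ℝ), (R.map Prod.swap).map Prod.swap = R := fun R => by
    rw [Measure.map_map measurable_swap measurable_swap]; simp
  -- The two first coordinates are drawn conditionally independently given the common second one.
  refine ⟨(l ⊗ₘ (κ₁ ×ₖ κ₂)).map fun p => (p.2.1, p.2.2, p.1), ?_, ?_⟩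
  · rw [Measure.map_map (by fun_prop) (by fun_prop), ← hsw R₁, ← h1]
    have e : l ⊗ₘ κ₁ = (l ⊗ₘ (κ₁ ×ₖ κ₂)).map (Prod.map id Prod.fst) := by
      rw [← Measure.compProd_map measurable_fst, ← Kernel.fst_eq, Kernel.fst_prod]
    rw [e, Measure.map_map (by fun_prop) (by fun_prop)]
    rfl
  · rw [Measure.map_map (by fun_prop) (by fun_prop), ← hsw R₂, ← h2]
    have e : l ⊗ₘ κ₂ = (l ⊗ₘ (κ₁ ×ₖ κ₂)).map (Prod.map id Prod.snd) := by
      rw [← Measure.compProd_map measurable_snd, ← Kernel.snd_eq, Kernel.snd_prod]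
    rw [e, Measure.map_map (by fun_prop) (by fun_prop)]
    rfl

/-- A sub-coupling of two laws with the same second marginal extends to a coupling. -/
lemma exists_extension_of_subcoupling (P₁ P₂ : Measure (ℝ × ℝ)) [IsFiniteMeasure P₁]
    [IsFiniteMeasure P₂] (h : P₁.map Prod.snd = P₂.map Prod.snd) (ρ : Measure (ℝ × ℝ × ℝ))
    [IsFiniteMeasure ρ]
    (h₁ : ρ.map (fun p => (p.1, p.2.2)) ≤ P₁) (h₂ : ρ.map (fun p => (p.2.1, p.2.2)) ≤ P₂) :
    ∃ ν : Measure (ℝ × ℝ × ℝ), ρ ≤ ν ∧ ν.map (fun p => (p.1, p.2.2)) = P₁ ∧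
      ν.map (fun p => (p.2.1, p.2.2)) = P₂ := by
  have e₁ := Measure.sub_add_cancel_of_le h₁
  have e₂ := Measure.sub_add_cancel_of_le h₂
  set R₁ := P₁ - ρ.map (fun p => (p.1, p.2.2))
  set R₂ := P₂ - ρ.map (fun p => (p.2.1, p.2.2))
  -- The parts of `P₁` and `P₂` not yet covered by `ρ` still share their second marginal, since both
  -- lost the same finite measure. They can be glued and added to `ρ`.
  have hR : R₁.map Prod.snd = R₂.map Prod.snd := by
    rw [← e₁, ← e₂, Measure.map_add _ _ measurable_snd, Measure.map_add _ _ measurable_snd,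
      Measure.map_map (by fun_prop) (by fun_prop), Measure.map_map (by fun_prop) (by fun_prop)] at h
    have h' : R₁.map Prod.snd + ρ.map (fun p => p.2.2) =
      R₂.map Prod.snd + ρ.map (fun p => p.2.2) := h
    ext s hs
    have := congrArg (fun m : Measure ℝ => m s) h'
    simp only [Measure.add_apply] at this
    exact (ENNReal.add_left_inj (measure_ne_top _ _)).1 this
  obtain ⟨ν, hν₁, hν₂⟩ := exists_gluing R₁ R₂ hR
  refine ⟨ν + ρ, Measure.le_add_left le_rfl, ?_, ?_⟩
  · rw [Measure.map_add _ _ (by fun_prop), hν₁, e₁]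
  · rw [Measure.map_add _ _ (by fun_prop), hν₂, e₂]

/-! ### Admissible pair laws and the Lipschitz hypothesis. -/

section PairLaws

variable {Ω : Type*} [MeasurableSpace Ω]

lemma IsStationary.map_eq {X : ℕ → Ω → ℝ} {μ : Measure Ω} (hX : ∀ n, Measurable (X n))
    (hs : IsStationary X μ) (n : ℕ) : μ.map (X n) = μ.map (X 0) := by
  have := congrArg (fun m => m.map (fun x : ℕ → ℝ => x 0)) (hs n)
  rw [Measure.map_map (by fun_prop) (by fun_prop), Measure.map_map (by fun_prop) (by fun_prop)]
    at this
  simpa [Function.comp_def] using this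

lemma IsStationary.map_pair_eq {X : ℕ → Ω → ℝ} {μ : Measure Ω} (hX : ∀ n, Measurable (X n))
    (hs : IsStationary X μ) (n k : ℕ) :
    μ.map (fun ω => (X n ω, X (n + k) ω)) = μ.map (fun ω => (X 0 ω, X k ω)) := by
  have := congrArg (fun m => m.map (fun x : ℕ → ℝ => (x 0, x k))) (hs n)
  rw [Measure.map_map (by fun_prop) (by fun_prop), Measure.map_map (by fun_prop) (by fun_prop)]
    at this
  simpa [Function.comp_def, add_comm] using this

lemma map_pair_mem_pairLaws {X : ℕ → Ω → ℝ} {μ : Measure Ω} (hX : ∀ n, Measurable (X n))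
    (hs : IsStationary X μ) {n k : ℕ} (hnk : n ≤ k) :
    μ.map (fun ω => (X n ω, X k ω)) ∈ pairLaws X μ := by
  obtain ⟨j, rfl⟩ := Nat.exists_eq_add_of_le hnk
  exact Or.inr ⟨j, hs.map_pair_eq hX n j⟩

lemma isProbabilityMeasure_of_mem_pairLaws {X : ℕ → Ω → ℝ} {μ : Measure Ω}
    [IsProbabilityMeasure μ] (hX : ∀ n, Measurable (X n)) {P : Measure (ℝ × ℝ)}
    (hP : P ∈ pairLaws X μ) : IsProbabilityMeasure P := by
  have := Measure.isProbabilityMeasure_map (μ := μ) (hX 0).aemeasurable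
  rcases hP with rfl | ⟨k, rfl⟩
  · infer_instance
  · exact Measure.isProbabilityMeasure_map ((hX 0).prodMk (hX k)).aemeasurable

lemma map_snd_of_mem_pairLaws {X : ℕ → Ω → ℝ} {μ : Measure Ω} [IsProbabilityMeasure μ]
    (hX : ∀ n, Measurable (X n)) (hs : IsStationary X μ) {P : Measure (ℝ × ℝ)}
    (hP : P ∈ pairLaws X μ) : P.map Prod.snd = μ.map (X 0) := by
  have := Measure.isProbabilityMeasure_map (μ := μ) (hX 0).aemeasurable
  rcases hP with rfl | ⟨k, rfl⟩
  · exact Measure.snd_prod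
  · rw [Measure.map_map measurable_snd ((hX 0).prodMk (hX k))]
    exact hs.map_eq hX k

/-- `𝒫`-Lipschitz continuity for sub-couplings. -/
lemma IsPLipschitz.lintegral_le {X : ℕ → Ω → ℝ} {μ : Measure Ω} [IsProbabilityMeasure μ]
    (hX : ∀ n, Measurable (X n)) (hs : IsStationary X μ) {h : ℝ → ℝ → ℝ} {L : ℝ}
    (hL : IsPLipschitz X μ h L) {ε : ℝ} (hε : 0 < ε) {P₁ P₂ : Measure (ℝ × ℝ)}
    (hP₁ : P₁ ∈ pairLaws X μ) (hP₂ : P₂ ∈ pairLaws X μ) {Z : Type*} [MeasurableSpace Z]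
    (S : Measure Z) [IsFiniteMeasure S] {x x' y : Z → ℝ} (hx : Measurable x) (hx' : Measurable x')
    (hy : Measurable y) (hS₁ : S.map (fun z => (x z, y z)) ≤ P₁)
    (hS₂ : S.map (fun z => (x' z, y z)) ≤ P₂) (hε' : ∀ᵐ z ∂S, |x z - x' z| ≤ ε)
    (hh : Measurable (fun p : ℝ × ℝ => h p.1 p.2)) :
    ∫⁻ z, ENNReal.ofReal |h (x z) (y z) - h (x' z) (y z)| ∂S ≤ ENNReal.ofReal (L * ε) := by
  have := isProbabilityMeasure_of_mem_pairLaws hX hP₁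
  have := isProbabilityMeasure_of_mem_pairLaws hX hP₂
  have hm : Measurable fun z => (x z, x' z, y z) := hx.prodMk (hx'.prodMk hy)
  obtain ⟨ν, hν, hν₁, hν₂⟩ := exists_extension_of_subcoupling P₁ P₂
    ((map_snd_of_mem_pairLaws hX hs hP₁).trans (map_snd_of_mem_pairLaws hX hs hP₂).symm)
    (S.map fun z => (x z, x' z, y z))
    (by rw [Measure.map_map (by fun_prop) hm]; exact hS₁)
    (by rw [Measure.map_map (by fun_prop) hm]; exact hS₂)
  refine le_trans ?_ (hL.2 ε hε ν (hν₁ ▸ hP₁) (hν₂ ▸ hP₂))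
  have hset : MeasurableSet {p : ℝ × ℝ × ℝ | |p.1 - p.2.1| ≤ ε} :=
    measurableSet_le (by fun_prop) measurable_const
  have hF : Measurable fun p : ℝ × ℝ × ℝ => ENNReal.ofReal |h p.1 p.2.2 - h p.2.1 p.2.2| := by
    have a1 : Measurable fun p : ℝ × ℝ × ℝ => h p.1 p.2.2 :=
      hh.comp (g := fun p : ℝ × ℝ => h p.1 p.2) (f := fun p : ℝ × ℝ × ℝ => (p.1, p.2.2)) (by fun_prop)
    have a2 : Measurable fun p : ℝ × ℝ × ℝ => h p.2.1 p.2.2 :=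
      hh.comp (g := fun p : ℝ × ℝ => h p.1 p.2) (f := fun p : ℝ × ℝ × ℝ => p.2) (by fun_prop)
    fun_prop
  calc _ = ∫⁻ p in {p : ℝ × ℝ × ℝ | |p.1 - p.2.1| ≤ ε},
        ENNReal.ofReal |h p.1 p.2.2 - h p.2.1 p.2.2| ∂(S.map fun z => (x z, x' z, y z)) := by
        rw [setLIntegral_map hset hF hm, Measure.restrict_eq_self_of_ae_mem]
        exact hε'
    _ ≤ _ := lintegral_mono' (Measure.restrict_mono le_rfl hν) le_rfl

end PairLaws

/-! ### Construction of the coupling on cells. -/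

/-- The indicator that `x` lies in the cell `j` of the partition given by the fibres of `c`. -/
def cellInd (c : ℝ → ℤ) (j : ℤ) (x : ℝ) : ENNReal := (c ⁻¹' {j}).indicator 1 x

lemma cellInd_measurable {c : ℝ → ℤ} (hc : Measurable c) (j : ℤ) : Measurable (cellInd c j) :=
  measurable_one.indicator (hc (measurableSet_singleton j))

lemma sum_cellInd_le (c : ℝ → ℤ) (J : Finset ℤ) (x : ℝ) : ∑ j ∈ J, cellInd c j x ≤ 1 := by
  have : ∀ j, cellInd c j x = if c x = j then 1 else 0 := fun j => by
    by_cases h : c x = j <;> simp [cellInd, h]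
  simp only [this, Finset.sum_ite_eq]
  split_ifs <;> simp

lemma lintegral_cellInd {c : ℝ → ℤ} (hc : Measurable c) (j : ℤ) (F : Measure ℝ) :
    ∫⁻ x, cellInd c j x ∂F = F (c ⁻¹' {j}) :=
  lintegral_indicator_one (hc (measurableSet_singleton j))

lemma lintegral_cellInd_comp {Ω : Type*} [MeasurableSpace Ω] {c : ℝ → ℤ} (hc : Measurable c) (j : ℤ)
    (μ : Measure Ω) {V : Ω → ℝ} (hV : Measurable V) (f : Ω → ENNReal) :
    ∫⁻ ω, cellInd c j (V ω) * f ω ∂μ = ∫⁻ ω in V ⁻¹' (c ⁻¹' {j}), f ω ∂μ := by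
  rw [← lintegral_indicator (hV (hc (measurableSet_singleton j)))]
  refine lintegral_congr fun ω => ?_
  by_cases h : c (V ω) = j <;> simp [cellInd, h]

/-- A density on `Ω × ℝ`, relative to `μ ⊗ F` with `F` the law of `V`, of a sub-coupling of `V` with
an independent copy of it that is independent of `m`: both variables lie in the same
cell of the partition given by `c`, and the missing mass is controlled by the mixing coefficient of
`V` and `m`. -/
lemma exists_coupling_density {Ω : Type*} {m : MeasurableSpace Ω} [mΩ : MeasurableSpace Ω]
    (hm : m ≤ mΩ) (μ : Measure Ω) [IsProbabilityMeasure μ] {V : Ω → ℝ} (hV : Measurable V) {a : ℝ}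
    (ha : ∀ A : Set ℝ, MeasurableSet A → ∀ B, MeasurableSet[m] B →
      |μ.real (V ⁻¹' A ∩ B) - μ.real (V ⁻¹' A) * μ.real B| ≤ a)
    {c : ℝ → ℤ} (hc : Measurable c) (J : Finset ℤ) :
    ∃ (k : Ω → ℝ → ENNReal) (g : ℝ → ℝ → ENNReal), Measurable (fun p : Ω × ℝ => k p.1 p.2) ∧
      Measurable (fun p : ℝ × ℝ => g p.1 p.2) ∧
      (∀ ω, ∫⁻ v, k ω v ∂(μ.map V) ≤ 1) ∧
      (∀ f : Ω → ENNReal, Measurable[m] f → ∀ v, ∫⁻ ω, k ω v * f ω ∂μ ≤ ∫⁻ ω, f ω ∂μ) ∧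
      (∀ ω v, k ω v ≠ 0 → c (V ω) = c v) ∧
      (∀ ω v, k ω v ≤ g (V ω) v) ∧
      (∀ v, ∫⁻ x, g x v ∂(μ.map V) ≤ 1) ∧
      1 ≤ ∫⁻ ω, ∫⁻ v, k ω v ∂(μ.map V) ∂μ +
        ENNReal.ofReal (μ.real {ω | c (V ω) ∉ J} + 32 / 3 * √J.card * a) := by
  set F := μ.map V with hF
  have : IsProbabilityMeasure F := Measure.isProbabilityMeasure_map hV.aemeasurable
  set E : ℤ → Set Ω := fun j => V ⁻¹' (c ⁻¹' {j}) with hE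
  have hcj : ∀ j, MeasurableSet (c ⁻¹' {j}) := fun j => hc (measurableSet_singleton j)
  have hEm : ∀ j, MeasurableSet (E j) := fun j => hV (hcj j)
  choose q hqm hq0 hq1 hqB hqf using fun j => exists_condProb hm μ (hEm j)
  set p : ℤ → ℝ := fun j => μ.real (E j) with hp
  have hp0 : ∀ j, 0 ≤ p j := fun j => measureReal_nonneg
  have hFp : ∀ j, F (c ⁻¹' {j}) = ENNReal.ofReal (p j) := fun j => by
    rw [hF, Measure.map_apply hV (hcj j), hp, ofReal_measureReal]
  -- The weight makes the retained mass `q * κ * p = min q p`, while `κ * p ≤ 1` and `q * κ ≤ 1`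
  -- control the two marginals. Division by zero gives `κ = 0`, consistently with a null cell.
  set κ : ℤ → Ω → ℝ := fun j ω => min (q j ω) (p j) / (q j ω * p j) with hκ
  have hκm : ∀ j, Measurable[m] (κ j) := fun j =>
    ((hqm j).min measurable_const).div ((hqm j).mul_const _)
  have hκ0 : ∀ j ω, 0 ≤ κ j ω := fun j ω => by
    have := hq0 j ω; have := hp0 j; positivity
  have hκp : ∀ j ω, κ j ω * p j ≤ 1 := fun j ω => by
    rcases (hp0 j).eq_or_lt with h | h
    · rw [← h]; simp
    rcases (hq0 j ω).eq_or_lt with h' | h'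
    · simp [hκ, ← h']
    · rw [hκ]; field_simp; exact min_le_left _ _
  have hκq : ∀ j ω, q j ω * κ j ω ≤ 1 := fun j ω => by
    rcases (hp0 j).eq_or_lt with h | h
    · simp [hκ, ← h]
    rcases (hq0 j ω).eq_or_lt with h' | h'
    · rw [← h']; simp
    · rw [hκ]; field_simp; exact min_le_right _ _
  have hκqp : ∀ j ω, q j ω * κ j ω * p j = min (q j ω) (p j) := fun j ω => by
    rcases (hp0 j).eq_or_lt with h | h
    · simp [hκ, ← h, hq0]
    rcases (hq0 j ω).eq_or_lt with h' | h'
    · simp [hκ, ← h', hp0]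
    · rw [hκ]; field_simp
  have hκle : ∀ j ω, κ j ω ≤ 1 / p j := fun j ω => by
    rcases (hp0 j).eq_or_lt with h | h
    · simp [hκ, ← h]
    · rw [le_div_iff₀ h]; exact hκp j ω
  have hind : ∀ j, Measurable (cellInd c j) := cellInd_measurable hc
  have hκm' : ∀ j, Measurable (κ j) := fun j => (hκm j).mono hm le_rfl
  have hkint : ∀ ω, ∫⁻ v, ∑ j ∈ J, cellInd c j (V ω) * ENNReal.ofReal (κ j ω) * cellInd c j v ∂F =
      ∑ j ∈ J, cellInd c j (V ω) * ENNReal.ofReal (κ j ω * p j) := fun ω => by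
    rw [lintegral_finsetSum _ fun j _ => by have := hind j; fun_prop]
    refine Finset.sum_congr rfl fun j _ => ?_
    rw [lintegral_const_mul _ (hind j), lintegral_cellInd hc, hFp, mul_assoc,
      ENNReal.ofReal_mul (hκ0 j ω)]
  refine ⟨fun ω v => ∑ j ∈ J, cellInd c j (V ω) * ENNReal.ofReal (κ j ω) * cellInd c j v,
    fun x v => ∑ j ∈ J, cellInd c j x * ENNReal.ofReal (1 / p j) * cellInd c j v,
    ?_, ?_, ?_, ?_, ?_, ?_, ?_, ?_⟩
  · refine Finset.measurable_sum _ fun j _ => ?_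
    have := hind j; have := hκm' j
    fun_prop
  · refine Finset.measurable_sum _ fun j _ => ?_
    have := hind j
    fun_prop
  · intro ω
    rw [hkint]
    refine (Finset.sum_le_sum fun j _ => ?_).trans (sum_cellInd_le c J (V ω))
    exact mul_le_of_le_one_right' (ENNReal.ofReal_le_one.2 (hκp j ω))
  · intro f hf v
    have hf' : Measurable f := hf.mono hm le_rfl
    simp_rw [Finset.sum_mul]
    rw [lintegral_finsetSum _ fun j _ => by
      have := hind j; have := hκm' j; fun_prop]
    calc _ ≤ ∑ j ∈ J, cellInd c j v * ∫⁻ ω, f ω ∂μ := Finset.sum_le_sum fun j _ => ?_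
      _ ≤ 1 * ∫⁻ ω, f ω ∂μ := by
        rw [← Finset.sum_mul]; exact mul_le_mul_left (sum_cellInd_le c J v) _
      _ = _ := one_mul _
    have e : ∀ ω, cellInd c j (V ω) * ENNReal.ofReal (κ j ω) * cellInd c j v * f ω =
        cellInd c j v * (cellInd c j (V ω) * (ENNReal.ofReal (κ j ω) * f ω)) := fun ω => by ring
    simp_rw [e]
    -- As `κ j` and `f` are `m`-measurable, conditioning replaces the indicator of `V` in cell `j`
    -- by `q j`.
    rw [lintegral_const_mul _ (by have := hind j; have := hκm' j; fun_prop),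
      lintegral_cellInd_comp hc j μ hV, 
      hqf j (fun ω => ENNReal.ofReal (κ j ω) * f ω) ((hκm j).ennreal_ofReal.mul hf)]
    gcongr with ω
    rw [← mul_assoc, ← ENNReal.ofReal_mul (hq0 j ω)]
    exact mul_le_of_le_one_left' (ENNReal.ofReal_le_one.2 (hκq j ω))
  · intro ω v hk
    obtain ⟨j, _, hj⟩ := Finset.exists_ne_zero_of_sum_ne_zero hk
    have h1 : c (V ω) = j := by
      by_contra h; exact hj (by simp [cellInd, h])
    have h2 : c v = j := by
      by_contra h; exact hj (by simp [cellInd, h])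
    rw [h1, h2]
  · intro ω v
    refine Finset.sum_le_sum fun j _ => ?_
    gcongr
    exact hκle j ω
  · intro v
    rw [lintegral_finsetSum _ fun j _ => by have := hind j; fun_prop]
    refine (Finset.sum_le_sum fun j _ => ?_).trans (sum_cellInd_le c J v)
    have e : ∀ x, cellInd c j x * ENNReal.ofReal (1 / p j) * cellInd c j v =
      (ENNReal.ofReal (1 / p j) * cellInd c j v) * cellInd c j x := fun x => by ring
    simp_rw [e]
    rw [lintegral_const_mul _ (hind j), lintegral_cellInd hc, hFp, mul_right_comm,
      ← ENNReal.ofReal_mul (by have := hp0 j; positivity)]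
    refine mul_le_of_le_one_left' (ENNReal.ofReal_le_one.2 ?_)
    rw [one_div_mul_eq_div]
    exact div_self_le_one _
  · simp_rw [hkint]
    rw [lintegral_finsetSum _ fun j _ => by have := hind j; have := hκm' j; fun_prop]
    have hmini : ∀ j, Integrable (fun ω => min (q j ω) (p j)) μ := fun j => by
      refine Integrable.of_bound (C := 1)
        (((hqm j).mono hm le_rfl).min measurable_const).aestronglyMeasurable
        (ae_of_all _ fun ω => ?_)
      rw [Real.norm_eq_abs, abs_of_nonneg (le_min (hq0 j ω) (hp0 j))]
      exact (min_le_left _ _).trans (hq1 j ω)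
    have h1 : ∀ j, ∫⁻ ω, cellInd c j (V ω) * ENNReal.ofReal (κ j ω * p j) ∂μ =
        ENNReal.ofReal (∫ ω, min (q j ω) (p j) ∂μ) := fun j => by
      rw [lintegral_cellInd_comp hc j μ hV, hqf j _ ((hκm j).mul_const _).ennreal_ofReal,
        ofReal_integral_eq_lintegral_ofReal (hmini j)
          (ae_of_all _ fun ω => le_min (hq0 j ω) (hp0 j))]
      refine lintegral_congr fun ω => ?_
      rw [← ENNReal.ofReal_mul (hq0 j ω), ← mul_assoc, hκqp]
    simp_rw [h1]
    have hmin0 : ∀ j, 0 ≤ ∫ ω, min (q j ω) (p j) ∂μ := fun j =>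
      integral_nonneg fun ω => le_min (hq0 j ω) (hp0 j)
    have ha0 : 0 ≤ a := (abs_nonneg _).trans (ha ∅ MeasurableSet.empty ∅ (@MeasurableSet.empty _ m))
    rw [← ENNReal.ofReal_sum_of_nonneg fun j _ => hmin0 j,
      ← ENNReal.ofReal_add (Finset.sum_nonneg fun j _ => hmin0 j) (by positivity),
      ← ENNReal.ofReal_one]
    refine ENNReal.ofReal_le_ofReal ?_
    have hdisj : Pairwise (Function.onFun Disjoint E) := fun i j hij =>
      Disjoint.preimage _ (Disjoint.preimage _ (by simpa using hij))
    have hTV := sum_integral_abs_condProb_sub_le hm μ E J hEm hdisj (a := a) (fun T B hB => by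
      have e : ⋃ j ∈ T, E j = V ⁻¹' (⋃ j ∈ T, c ⁻¹' {j}) := by ext ω; simp [hE]
      rw [e]
      exact ha _ (Finset.measurableSet_biUnion _ fun j _ => hcj j) B hB) q hqm hq0 hq1 hqB
    have hsum : ∑ j ∈ J, p j = 1 - μ.real {ω | c (V ω) ∉ J} := by
      rw [hp, ← measureReal_biUnion_finset (fun i _ j _ hij => hdisj hij) (fun j _ => hEm j),
        ← probReal_compl_eq_one_sub]
      · congr 1; ext ω; simp [hE]
      · exact hV (hc (J.measurableSet.compl))
    -- From `min q p ≥ p - |q - p|`: the mass lost on the cells of `J` is at most the integrated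
    -- total variation distance.
    have hmin : ∀ j, p j - ∫ ω, |q j ω - p j| ∂μ ≤ ∫ ω, min (q j ω) (p j) ∂μ := fun j => by
      have hi : Integrable (fun ω => |q j ω - p j|) μ := by
        refine Integrable.abs (Integrable.sub ?_ (integrable_const _))
        refine Integrable.of_bound (C := 1) ((hqm j).mono hm le_rfl).aestronglyMeasurable
          (ae_of_all _ fun ω => ?_)
        rw [Real.norm_eq_abs, abs_of_nonneg (hq0 j ω)]
        exact hq1 j ω
      have : p j - ∫ ω, |q j ω - p j| ∂μ = ∫ ω, (p j - |q j ω - p j|) ∂μ := by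
        rw [integral_sub (integrable_const _) hi]; simp
      rw [this]
      refine integral_mono ((integrable_const _).sub hi) (hmini j) fun ω => ?_
      refine le_min ?_ ?_
      · have := neg_abs_le (q j ω - p j); linarith
      · have := abs_nonneg (q j ω - p j); linarith
    have := Finset.sum_le_sum fun j (_ : j ∈ J) => hmin j
    rw [Finset.sum_sub_distrib, hsum] at this
    linarith

/-- This is `(1 - u) * (1 - w) ≥ 0`. It acts as a union bound: retaining both couplings loses at
most the sum of the two losses. -/
lemma ENNReal_add_le_one_add_mul {u w : ENNReal} (hu : u ≤ 1) (hw : w ≤ 1) :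
    u + w ≤ 1 + u * w := by
  lift u to NNReal using ne_top_of_le_ne_top ENNReal.one_ne_top hu
  lift w to NNReal using ne_top_of_le_ne_top ENNReal.one_ne_top hw
  norm_cast at *
  rw [← NNReal.coe_le_coe] at *
  push_cast at *
  nlinarith [mul_nonneg (sub_nonneg.2 hu) (sub_nonneg.2 hw)]

lemma map_le_of_lintegral_le {Z T : Type*} [MeasurableSpace Z] [MeasurableSpace T] {S : Measure Z}
    {φ : Z → T} (hφ : Measurable φ) {P : Measure T}
    (h : ∀ f : T → ENNReal, Measurable f → ∫⁻ z, f (φ z) ∂S ≤ ∫⁻ t, f t ∂P) : S.map φ ≤ P := by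
  rw [Measure.le_iff]
  intro s hs
  rw [← lintegral_indicator_one hs, ← lintegral_indicator_one hs,
    lintegral_map (measurable_one.indicator hs) hφ]
  exact h _ (measurable_one.indicator hs)

/-- Simultaneous sub-coupling: on `Ω × ℝ × ℝ`, the second coordinate is close to `V` and independent
of `W`, the third one is close to `Y` and independent of `V` and of the second coordinate. -/
lemma exists_double_subcoupling {Ω 𝒲 : Type*} {m : MeasurableSpace Ω} [mΩ : MeasurableSpace Ω]
    [MeasurableSpace 𝒲] (hm : m ≤ mΩ) (μ : Measure Ω) [IsProbabilityMeasure μ] {V Y : Ω → ℝ}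
    {W : Ω → 𝒲} (hV : Measurable V) (hY : Measurable[m] Y) (hW : Measurable[m] W) {F : Measure ℝ}
    (hVF : μ.map V = F) (hYF : μ.map Y = F) {a : ℝ}
    (ha : ∀ A : Set ℝ, MeasurableSet A → ∀ B, MeasurableSet[m] B →
      |μ.real (V ⁻¹' A ∩ B) - μ.real (V ⁻¹' A) * μ.real B| ≤ a)
    {c : ℝ → ℤ} (hc : Measurable c) (J : Finset ℤ) :
    ∃ S : Measure (Ω × ℝ × ℝ), S.map Prod.fst ≤ μ ∧
      S.map (fun z => (W z.1, z.2.1)) ≤ (μ.map W).prod F ∧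
      S.map (fun z => (V z.1, z.2.2)) ≤ F.prod F ∧
      S.map (fun z => (z.2.1, z.2.2)) ≤ F.prod F ∧
      (∀ᵐ z ∂S, c (V z.1) = c z.2.1 ∧ c (Y z.1) = c z.2.2) ∧
      1 ≤ S Set.univ + ENNReal.ofReal (2 * (F.real {x | c x ∉ J} + 32 / 3 * √J.card * a)) := by
  have hY' : Measurable Y := hY.mono hm le_rfl
  have hW' : Measurable W := hW.mono hm le_rfl
  have hFprob : IsProbabilityMeasure F := hVF ▸ Measure.isProbabilityMeasure_map hV.aemeasurable
  have hWprob : IsProbabilityMeasure (μ.map W) := Measure.isProbabilityMeasure_map hW'.aemeasurable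
  have ha0 : 0 ≤ a := (abs_nonneg _).trans (ha ∅ MeasurableSet.empty ∅ (@MeasurableSet.empty _ m))
  obtain ⟨k₁, g₁, hk₁, hg₁, a₁, b₁, c₁, d₁, e₁, f₁⟩ := exists_coupling_density hm μ hV ha hc J
  -- The same construction with reversed roles: `Y` is coupled to a copy independent of `V`. The
  -- mixing bound is symmetric and `Y` is `m`-measurable.
  obtain ⟨k₂, g₂, hk₂, hg₂, a₂, b₂, c₂, d₂, e₂, f₂⟩ := exists_coupling_density
    (m := MeasurableSpace.comap V inferInstance) hV.comap_le μ hY' (a := a) (by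
      rintro A hA _ ⟨B, hB, rfl⟩
      have := ha B hB _ (hY hA)
      rwa [Set.inter_comm, mul_comm] at this) hc J
  have hμF : ∀ {U : Ω → ℝ}, Measurable U → μ.map U = F →
      μ.real {ω | c (U ω) ∉ J} = F.real {x | c x ∉ J} := fun {U} hU h => by
    rw [← h, map_measureReal_apply hU (s := {x | c x ∉ J}) (hc (J.measurableSet.compl))]; rfl
  rw [hVF, hμF hV hVF] at f₁
  rw [hYF, hμF hY' hYF] at f₂
  rw [hVF] at a₁ e₁
  rw [hYF] at a₂ e₂
  set r := ENNReal.ofReal (F.real {x | c x ∉ J} + 32 / 3 * √J.card * a) with hr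
  have hk₁v : ∀ ω, Measurable (k₁ ω) := fun ω => hk₁.comp measurable_prodMk_left
  have hk₂v : ∀ ω, Measurable (k₂ ω) := fun ω => hk₂.comp measurable_prodMk_left
  have hD : Measurable fun z : Ω × ℝ × ℝ => k₁ z.1 z.2.1 * k₂ z.1 z.2.2 :=
    (hk₁.comp (g := fun p : Ω × ℝ => k₁ p.1 p.2) (f := fun z : Ω × ℝ × ℝ => (z.1, z.2.1))
      (by fun_prop)).mul
    (hk₂.comp (g := fun p : Ω × ℝ => k₂ p.1 p.2) (f := fun z : Ω × ℝ × ℝ => (z.1, z.2.2))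
      (by fun_prop))
  set S := (μ.prod (F.prod F)).withDensity fun z => k₁ z.1 z.2.1 * k₂ z.1 z.2.2 with hS
  have hint : ∀ f : Ω × ℝ × ℝ → ENNReal, Measurable f →
      ∫⁻ z, f z ∂S = ∫⁻ ω, ∫⁻ v, ∫⁻ y, k₁ ω v * k₂ ω y * f (ω, v, y) ∂F ∂F ∂μ := fun f hf => by
    rw [hS, lintegral_withDensity_eq_lintegral_mul _ hD hf, lintegral_prod _ (by fun_prop)]
    refine lintegral_congr fun ω => ?_
    rw [lintegral_prod]
    · rfl
    · exact ((hD.mul hf).comp measurable_prodMk_left).aemeasurable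
  refine ⟨S, map_le_of_lintegral_le measurable_fst ?_,
    map_le_of_lintegral_le (by fun_prop) ?_, map_le_of_lintegral_le (by fun_prop) ?_,
    map_le_of_lintegral_le (by fun_prop) ?_, ?_, ?_⟩
  · intro f hf
    rw [hint _ (by fun_prop)]
    refine lintegral_mono fun ω => ?_
    calc _ = ∫⁻ v, k₁ ω v * (∫⁻ y, k₂ ω y ∂F) * f ω ∂F := by
          refine lintegral_congr fun v => ?_
          rw [← lintegral_const_mul _ (hk₂v ω),
            ← lintegral_mul_const _ ((hk₂v ω).const_mul (k₁ ω v))]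
      _ ≤ ∫⁻ v, k₁ ω v * 1 * f ω ∂F := by gcongr; exact a₂ ω
      _ ≤ 1 * f ω := by
          simp only [mul_one]
          rw [lintegral_mul_const _ (hk₁v ω)]
          gcongr; exact a₁ ω
      _ = f ω := one_mul _
  · intro f hf
    rw [hint _ (by fun_prop)]
    calc _ ≤ ∫⁻ ω, ∫⁻ v, k₁ ω v * f (W ω, v) ∂F ∂μ := by
          refine lintegral_mono fun ω => lintegral_mono fun v => ?_
          dsimp only
          rw [lintegral_mul_const _ ((hk₂v ω).const_mul (k₁ ω v)), lintegral_const_mul _ (hk₂v ω)]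
          gcongr
          exact mul_le_of_le_one_right' (a₂ ω)
      _ = ∫⁻ v, ∫⁻ ω, k₁ ω v * f (W ω, v) ∂μ ∂F :=
          lintegral_lintegral_swap (by unfold Function.uncurry; fun_prop)
      _ ≤ ∫⁻ v, ∫⁻ ω, f (W ω, v) ∂μ ∂F := by
          refine lintegral_mono fun v => ?_
          exact b₁ (fun ω => f (W ω, v)) ((hf.comp measurable_prodMk_right).comp hW) v
      _ = _ := by
          rw [lintegral_prod_symm' _ hf]
          refine lintegral_congr fun v => ?_
          rw [lintegral_map (f := fun x => f (x, v)) (hf.comp measurable_prodMk_right) hW']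
  · intro f hf
    rw [hint _ (by fun_prop)]
    calc _ = ∫⁻ ω, ∫⁻ y, ∫⁻ v, k₁ ω v * k₂ ω y * f (V ω, y) ∂F ∂F ∂μ := by
          refine lintegral_congr fun ω => ?_
          exact lintegral_lintegral_swap (by
            have := hk₁v ω; have := hk₂v ω
            unfold Function.uncurry; fun_prop)
      _ ≤ ∫⁻ ω, ∫⁻ y, k₂ ω y * f (V ω, y) ∂F ∂μ := by
          gcongr with ω y
          simp_rw [mul_assoc]
          rw [lintegral_mul_const _ (hk₁v ω)]
          exact mul_le_of_le_one_left' (a₁ ω)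
      _ = ∫⁻ y, ∫⁻ ω, k₂ ω y * f (V ω, y) ∂μ ∂F :=
          lintegral_lintegral_swap (by unfold Function.uncurry; fun_prop)
      _ ≤ ∫⁻ y, ∫⁻ ω, f (V ω, y) ∂μ ∂F := by
          refine lintegral_mono fun y => ?_
          exact b₂ (fun ω => f (V ω, y)) ((hf.comp measurable_prodMk_right).comp (comap_measurable V)) y
      _ = _ := by
          rw [lintegral_prod_symm' _ hf]
          refine lintegral_congr fun v => ?_
          rw [← hVF, lintegral_map (f := fun x => f (x, v)) (hf.comp measurable_prodMk_right) hV]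
  · intro f hf
    rw [hint _ (by fun_prop)]
    calc _ = ∫⁻ ω, ∫⁻ p : ℝ × ℝ, k₁ ω p.1 * k₂ ω p.2 * f p ∂(F.prod F) ∂μ := by
          refine lintegral_congr fun ω => ?_
          rw [lintegral_prod]
          have := hk₁v ω; have := hk₂v ω
          fun_prop
      _ = ∫⁻ p : ℝ × ℝ, ∫⁻ ω, k₁ ω p.1 * k₂ ω p.2 * f p ∂μ ∂(F.prod F) :=
          lintegral_lintegral_swap (by
            refine (hD.mul (hf.comp measurable_snd)).aemeasurable)
      _ ≤ ∫⁻ p : ℝ × ℝ, f p ∂(F.prod F) := by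
          refine lintegral_mono fun p => ?_
          dsimp only
          have hk₁p : Measurable fun ω => k₁ ω p.1 := hk₁.comp measurable_prodMk_right
          have hk₂p : Measurable fun ω => k₂ ω p.2 := hk₂.comp measurable_prodMk_right
          have hg₂p : Measurable fun x => g₂ x p.2 := hg₂.comp measurable_prodMk_right
          rw [lintegral_mul_const (f := fun ω => k₁ ω p.1 * k₂ ω p.2) _ (hk₁p.mul hk₂p)]
          refine mul_le_of_le_one_left' ?_
          -- The weight `k₂` may depend on `V`, so `b₁` does not apply to it. Its majorant `g₂ (Y
          -- ω)` is `m`-measurable and still integrates to at most one.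
          calc _ ≤ ∫⁻ ω, k₁ ω p.1 * g₂ (Y ω) p.2 ∂μ := by gcongr with ω; exact d₂ _ _
            _ ≤ ∫⁻ ω, g₂ (Y ω) p.2 ∂μ := b₁ _ (hg₂p.comp hY) _
            _ ≤ 1 := by
              rw [← lintegral_map (f := fun x => g₂ x p.2) hg₂p hY', hYF]
              exact e₂ _
  · rw [hS, ae_withDensity_iff hD]
    refine ae_of_all _ fun z hz => ?_
    exact ⟨c₁ _ _ (left_ne_zero_of_mul hz), c₂ _ _ (right_ne_zero_of_mul hz)⟩
  · have hmass : S Set.univ = ∫⁻ ω, (∫⁻ v, k₁ ω v ∂F) * ∫⁻ y, k₂ ω y ∂F ∂μ := by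
      rw [← lintegral_one, hint _ measurable_const]
      refine lintegral_congr fun ω => ?_
      rw [← lintegral_mul_const _ (hk₁v ω)]
      refine lintegral_congr fun v => ?_
      rw [← lintegral_const_mul _ (hk₂v ω)]
      simp
    have hu : Measurable fun ω => ∫⁻ v, k₁ ω v ∂F := hk₁.lintegral_prod_right'
    have hle2 : (∫⁻ ω, ∫⁻ v, k₁ ω v ∂F ∂μ) + (∫⁻ ω, ∫⁻ y, k₂ ω y ∂F ∂μ) ≤ 1 + S Set.univ := by
      rw [← lintegral_add_left hu, hmass]
      calc _ ≤ ∫⁻ ω, (1 + (∫⁻ v, k₁ ω v ∂F) * ∫⁻ y, k₂ ω y ∂F) ∂μ :=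
            lintegral_mono fun ω => ENNReal_add_le_one_add_mul (a₁ ω) (a₂ ω)
        _ = _ := by rw [lintegral_add_left measurable_const]; simp
    have h2r : ENNReal.ofReal (2 * (F.real {x | c x ∉ J} + 32 / 3 * √J.card * a)) = r + r := by
      rw [hr, ← ENNReal.ofReal_add (by positivity) (by positivity), two_mul]
    rw [h2r]
    refine (ENNReal.add_le_add_iff_left ENNReal.one_ne_top).1 ?_
    calc (1 : ENNReal) + 1 ≤ _ := add_le_add f₁ f₂
      _ = ((∫⁻ ω, ∫⁻ v, k₁ ω v ∂F ∂μ) + (∫⁻ ω, ∫⁻ y, k₂ ω y ∂F ∂μ)) + (r + r) := by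
        abel
      _ ≤ 1 + S Set.univ + (r + r) := by gcongr
      _ = _ := by rw [add_assoc]

/-! ### Moments and degeneracy of the Hoeffding kernel; truncation inequalities. -/

lemma eLpNorm_le_iff_lintegral {T : Type*} [MeasurableSpace T] {P : Measure T} {f : T → ℝ} {q : ℝ}
    (hq : 0 < q) (C : ENNReal) : eLpNorm f (ENNReal.ofReal q) P ≤ C ^ (1 / q) ↔
      ∫⁻ t, ENNReal.ofReal (|f t| ^ q) ∂P ≤ C := by
  rw [eLpNorm_eq_lintegral_rpow_enorm_toReal (by simpa using hq) ENNReal.ofReal_ne_top,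
    ENNReal.toReal_ofReal hq.le, ENNReal.rpow_le_rpow_iff (by positivity)]
  have : ∀ t, ‖f t‖ₑ ^ q = ENNReal.ofReal (|f t| ^ q) := fun t => by
    rw [← ENNReal.ofReal_rpow_of_nonneg (abs_nonneg _) hq.le, ← Real.norm_eq_abs,
      ofReal_norm]
  simp_rw [this]

/-- The section integrals `x ↦ ∫ h(x, y) dF(y)` inherit moment bounds. -/
lemma eLpNorm_integral_section_le {F : Measure ℝ} [IsProbabilityMeasure F] {h : ℝ → ℝ → ℝ}
    (hh : Measurable fun p : ℝ × ℝ => h p.1 p.2) {q : ℝ} (hq : 1 ≤ q) :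
    eLpNorm (fun x => ∫ y, h x y ∂F) (ENNReal.ofReal q) F ≤
      eLpNorm (fun p : ℝ × ℝ => h p.1 p.2) (ENNReal.ofReal q) (F.prod F) := by
  have hq0 : 0 < q := by linarith
  rw [eLpNorm_eq_lintegral_rpow_enorm_toReal (by simpa using hq0) ENNReal.ofReal_ne_top,
    eLpNorm_eq_lintegral_rpow_enorm_toReal (by simpa using hq0) ENNReal.ofReal_ne_top,
    ENNReal.toReal_ofReal hq0.le, lintegral_prod _ (by fun_prop)]
  gcongr with x
  have hx : Measurable (h x) := hh.comp measurable_prodMk_left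
  have h1 : ‖∫ y, h x y ∂F‖ₑ ≤ eLpNorm (h x) (ENNReal.ofReal q) F :=
    (enorm_integral_le_lintegral_enorm _).trans (by
      rw [← eLpNorm_one_eq_lintegral_enorm]
      exact eLpNorm_le_eLpNorm_of_exponent_le (by simpa using hq) hx.aestronglyMeasurable)
  calc _ ≤ (eLpNorm (h x) (ENNReal.ofReal q) F) ^ q := by gcongr
    _ = _ := by
      rw [eLpNorm_eq_lintegral_rpow_enorm_toReal (by simpa using hq0) ENNReal.ofReal_ne_top,
        ENNReal.toReal_ofReal hq0.le, ← ENNReal.rpow_mul, one_div_mul_cancel hq0.ne',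
        ENNReal.rpow_one]

lemma measurable_section_integral {F : Measure ℝ} [IsProbabilityMeasure F] {h : ℝ → ℝ → ℝ}
    (hh : Measurable fun p : ℝ × ℝ => h p.1 p.2) : Measurable fun x => ∫ y, h x y ∂F :=
  (StronglyMeasurable.integral_prod_right (f := h) hh.stronglyMeasurable).measurable

lemma measurable_hoeff1 {F : Measure ℝ} [IsProbabilityMeasure F] {h : ℝ → ℝ → ℝ}
    (hh : Measurable fun p : ℝ × ℝ => h p.1 p.2) : Measurable (hoeff1 F h) :=
  (measurable_section_integral hh).sub_const _

lemma measurable_hoeff2 {F : Measure ℝ} [IsProbabilityMeasure F] {h : ℝ → ℝ → ℝ}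
    (hh : Measurable fun p : ℝ × ℝ => h p.1 p.2) :
    Measurable fun p : ℝ × ℝ => hoeff2 F h p.1 p.2 :=
  ((hh.sub ((measurable_hoeff1 hh).comp measurable_fst)).sub
    ((measurable_hoeff1 hh).comp measurable_snd)).sub_const _

/-- Moments of the degenerate part of the Hoeffding decomposition. -/
lemma lintegral_hoeff2_le {F : Measure ℝ} [IsProbabilityMeasure F] {h : ℝ → ℝ → ℝ}
    (hh : Measurable fun p : ℝ × ℝ => h p.1 p.2) {q : ℝ} (hq : 1 ≤ q) {M : ℝ}
    {P : Measure (ℝ × ℝ)} [IsProbabilityMeasure P] (hP₁ : P.map Prod.fst = F)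
    (hP₂ : P.map Prod.snd = F)
    (hF : ∫⁻ p : ℝ × ℝ, ENNReal.ofReal (|h p.1 p.2| ^ q) ∂(F.prod F) ≤ ENNReal.ofReal M)
    (hP : ∫⁻ p : ℝ × ℝ, ENNReal.ofReal (|h p.1 p.2| ^ q) ∂P ≤ ENNReal.ofReal M) :
    ∫⁻ p : ℝ × ℝ, ENNReal.ofReal (|hoeff2 F h p.1 p.2| ^ q) ∂P ≤ ENNReal.ofReal (4 ^ q * M) := by
  have hq0 : 0 < q := by linarith
  rw [← eLpNorm_le_iff_lintegral hq0] at hF hP ⊢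
  set B := ENNReal.ofReal M ^ (1 / q) with hB
  have hp1 : 1 ≤ ENNReal.ofReal q := by simpa using hq
  have hB4 : ENNReal.ofReal (4 ^ q * M) ^ (1 / q) = 4 * B := by
    rw [ENNReal.ofReal_mul (by positivity), ENNReal.mul_rpow_of_nonneg _ _ (by positivity),
      ← ENNReal.ofReal_rpow_of_nonneg (by norm_num) hq0.le, ← ENNReal.rpow_mul,
      mul_one_div_cancel hq0.ne', ENNReal.rpow_one, ← hB]
    norm_num
  rw [hB4]
  have hGm := measurable_section_integral (F := F) hh
  have hG : eLpNorm (fun x => ∫ y, h x y ∂F) (ENNReal.ofReal q) F ≤ B :=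
    (eLpNorm_integral_section_le hh hq).trans hF
  have hG₁ : eLpNorm (fun p : ℝ × ℝ => ∫ y, h p.1 y ∂F) (ENNReal.ofReal q) P ≤ B := by
    refine le_of_eq_of_le ?_ hG
    have := eLpNorm_map_measure (p := ENNReal.ofReal q) (μ := P) (f := Prod.fst)
      hGm.aestronglyMeasurable measurable_fst.aemeasurable
    rw [hP₁] at this
    exact this.symm
  have hG₂ : eLpNorm (fun p : ℝ × ℝ => ∫ y, h p.2 y ∂F) (ENNReal.ofReal q) P ≤ B := by
    refine le_of_eq_of_le ?_ hG
    have := eLpNorm_map_measure (p := ENNReal.ofReal q) (μ := P) (f := Prod.snd)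
      hGm.aestronglyMeasurable measurable_snd.aemeasurable
    rw [hP₂] at this
    exact this.symm
  have hθ : eLpNorm (fun _ : ℝ × ℝ => theta F h) (ENNReal.ofReal q) P ≤ B := by
    rw [eLpNorm_const _ (by simpa using hq0) (IsProbabilityMeasure.ne_zero P)]
    simp only [measure_univ, ENNReal.one_rpow, mul_one]
    refine (enorm_integral_le_lintegral_enorm _).trans ?_
    rw [← eLpNorm_one_eq_lintegral_enorm]
    exact (eLpNorm_le_eLpNorm_of_exponent_le hp1 hh.aestronglyMeasurable).trans hF
  -- Written with the section integrals instead of `hoeff1`, the kernel has four terms, each of norm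
  -- at most `B`; hence the factor `4 ^ q`.
  have e : (fun p : ℝ × ℝ => hoeff2 F h p.1 p.2) = (((fun p : ℝ × ℝ => h p.1 p.2) -
      fun p : ℝ × ℝ => ∫ y, h p.1 y ∂F) - fun p : ℝ × ℝ => ∫ y, h p.2 y ∂F) +
      fun _ => theta F h := by
    ext p; simp only [hoeff2, hoeff1, Pi.add_apply, Pi.sub_apply]; ring
  have m1 : Measurable fun p : ℝ × ℝ => ∫ y, h p.1 y ∂F := hGm.comp measurable_fst
  have m2 : Measurable fun p : ℝ × ℝ => ∫ y, h p.2 y ∂F := hGm.comp measurable_snd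
  rw [e]
  refine (eLpNorm_add_le ((hh.sub m1).sub m2).aestronglyMeasurable aestronglyMeasurable_const
    hp1).trans ?_
  refine (add_le_add_left (eLpNorm_sub_le (hh.sub m1).aestronglyMeasurable m2.aestronglyMeasurable
    hp1) _).trans ?_
  refine (add_le_add_left (add_le_add_left (eLpNorm_sub_le hh.aestronglyMeasurable
    m1.aestronglyMeasurable hp1) _) _).trans ?_
  calc _ ≤ B + B + B + B := by gcongr
    _ = 4 * B := by ring

lemma integrable_of_lintegral_rpow_le {T : Type*} [MeasurableSpace T] {P : Measure T}
    [IsFiniteMeasure P] {f : T → ℝ} (hf : Measurable f) {q : ℝ} (hq : 1 ≤ q) {C : ℝ}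
    (h : ∫⁻ t, ENNReal.ofReal (|f t| ^ q) ∂P ≤ ENNReal.ofReal C) : Integrable f P := by
  rw [← eLpNorm_le_iff_lintegral (by linarith)] at h
  have : MemLp f (ENNReal.ofReal q) P := ⟨hf.aestronglyMeasurable, h.trans_lt (by finiteness)⟩
  exact this.integrable (by simpa using hq)

/-- The degenerate part has vanishing conditional expectations under the product law. -/
lemma ae_integral_hoeff2_eq_zero {F : Measure ℝ} [IsProbabilityMeasure F] {h : ℝ → ℝ → ℝ}
    (hh : Integrable (fun p : ℝ × ℝ => h p.1 p.2) (F.prod F)) (hsym : ∀ x y, h x y = h y x) :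
    ∀ᵐ y ∂F, ∫ v, hoeff2 F h v y ∂F = 0 := by
  filter_upwards [hh.prod_right_ae] with y hy
  have hy' : Integrable (fun v => h v y) F := by simpa only [hsym _ y] using hy
  have hG : Integrable (fun x => ∫ y, h x y ∂F) F := hh.integral_prod_left
  have h1 : Integrable (hoeff1 F h) F := hG.sub (integrable_const _)
  have hθ : ∫ x, ∫ y, h x y ∂F ∂F = theta F h := (integral_prod _ hh).symm
  have h10 : ∫ v, hoeff1 F h v ∂F = 0 := by
    simp only [hoeff1]
    rw [integral_sub hG (integrable_const _), hθ]; simp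
  have e : ∫ v, hoeff2 F h v y ∂F =
      ∫ v, ((h v y - hoeff1 F h v) - (hoeff1 F h y + theta F h)) ∂F :=
    integral_congr_ae (ae_of_all _ fun v => by simp only [hoeff2]; ring)
  rw [e, integral_sub (f := fun v => h v y - hoeff1 F h v) (hy'.sub h1) (integrable_const _),
    integral_sub hy' h1, h10]
  have : ∫ v, h v y ∂F = ∫ v, h y v ∂F := integral_congr_ae (ae_of_all _ fun v => hsym v y)
  rw [this, hoeff1]
  simp

lemma le_add_rpow {A δ t : ℝ} (hA : 0 < A) (hδ : 0 < δ) (ht : 0 ≤ t) :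
    t ≤ A + A ^ (-(δ / 2)) * t ^ (1 + δ / 2) := by
  rcases le_or_gt t A with h | h
  · have : 0 ≤ A ^ (-(δ / 2)) * t ^ (1 + δ / 2) := by positivity
    linarith
  · have ht0 : 0 < t := hA.trans h
    have h1 : 1 ≤ A ^ (-(δ / 2)) * t ^ (δ / 2) := by
      rw [Real.rpow_neg hA.le, inv_mul_eq_div, one_le_div (by positivity)]
      gcongr
    rw [Real.rpow_add ht0, Real.rpow_one]
    nlinarith

/-- Removing a small part of a probability measure changes integrals of functions with a higher
moment only slightly. -/
lemma abs_integral_sub_integral_le {T : Type*} [MeasurableSpace T] {P Q : Measure T}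
    [IsProbabilityMeasure P] (hQ : Q ≤ P) {f : T → ℝ} (hfm : Measurable f) (hf : Integrable f P)
    {δ C r A : ℝ} (hδ : 0 < δ) (hA : 0 < A) (hr : 0 ≤ r) (hC : 0 ≤ C)
    (hmom : ∫⁻ t, ENNReal.ofReal (|f t| ^ (1 + δ / 2)) ∂P ≤ ENNReal.ofReal C)
    (hmass : 1 ≤ Q Set.univ + ENNReal.ofReal r) :
    |∫ t, f t ∂P - ∫ t, f t ∂Q| ≤ A * r + A ^ (-(δ / 2)) * C := by
  have : IsFiniteMeasure Q := isFiniteMeasure_of_le P hQ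
  have e := Measure.sub_add_cancel_of_le hQ
  set D := P - Q
  have hD : D ≤ P := Measure.sub_le
  have hu : D Set.univ ≤ ENNReal.ofReal r := by
    have h1 : D Set.univ + Q Set.univ = 1 := by
      rw [← Measure.add_apply, e, measure_univ]
    refine (ENNReal.add_le_add_iff_left (measure_ne_top Q Set.univ)).1 ?_
    rw [add_comm, h1]; exact hmass
  have h1 : ∫ t, f t ∂P - ∫ t, f t ∂Q = ∫ t, f t ∂D := by
    conv_lhs => rw [← e]
    rw [integral_add_measure (hf.mono_measure hD) (hf.mono_measure hQ)]; ring
  rw [h1, ← Real.norm_eq_abs]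
  have h2 : ENNReal.ofReal ‖∫ t, f t ∂D‖ ≤ ENNReal.ofReal (A * r + A ^ (-(δ / 2)) * C) := by
    rw [ofReal_norm]
    refine (enorm_integral_le_lintegral_enorm _).trans ?_
    calc ∫⁻ t, ‖f t‖ₑ ∂D ≤ ∫⁻ t, (ENNReal.ofReal A + ENNReal.ofReal (A ^ (-(δ / 2))) *
          ENNReal.ofReal (|f t| ^ (1 + δ / 2))) ∂D := by
          refine lintegral_mono fun t => ?_
          dsimp only
          rw [← ofReal_norm, Real.norm_eq_abs, ← ENNReal.ofReal_mul (by positivity),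
            ← ENNReal.ofReal_add hA.le (by positivity)]
          exact ENNReal.ofReal_le_ofReal (le_add_rpow hA hδ (abs_nonneg _))
      _ = ENNReal.ofReal A * D Set.univ + ENNReal.ofReal (A ^ (-(δ / 2))) *
          ∫⁻ t, ENNReal.ofReal (|f t| ^ (1 + δ / 2)) ∂D := by
          rw [lintegral_add_left measurable_const, lintegral_const,
            lintegral_const_mul _ (by fun_prop)]
      _ ≤ ENNReal.ofReal A * ENNReal.ofReal r + ENNReal.ofReal (A ^ (-(δ / 2))) *
          ENNReal.ofReal C := by
          gcongr
          exact (lintegral_mono' hD le_rfl).trans hmom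
      _ = _ := by
          rw [← ENNReal.ofReal_mul hA.le, ← ENNReal.ofReal_mul (by positivity),
            ← ENNReal.ofReal_add (by positivity) (by positivity)]
  exact (ENNReal.ofReal_le_ofReal_iff (by positivity)).1 h2

lemma abs_mul_rpow_le {δ u g : ℝ} (hδ : 0 < δ) :
    |u * g| ^ (1 + δ / 2) ≤ |u| ^ (2 + δ) + |g| ^ (2 + δ) := by
  have h : ∀ x y : ℝ, 0 ≤ x → 0 ≤ y → x ≤ y → (x * y) ^ (1 + δ / 2) ≤ y ^ (2 + δ) := by
    intro x y hx hy hxy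
    calc (x * y) ^ (1 + δ / 2) ≤ (y ^ (2 : ℝ)) ^ (1 + δ / 2) := by
          gcongr; rw [Real.rpow_two]; nlinarith
      _ = y ^ (2 + δ) := by rw [← Real.rpow_mul hy]; ring_nf
  rw [abs_mul]
  have a1 : 0 ≤ |u| ^ (2 + δ) := by positivity
  have a2 : 0 ≤ |g| ^ (2 + δ) := by positivity
  rcases le_total |u| |g| with hl | hl
  · linarith [h _ _ (abs_nonneg u) (abs_nonneg g) hl]
  · rw [mul_comm]
    linarith [h _ _ (abs_nonneg g) (abs_nonneg u) hl]

/-- Only `g` is truncated, since it is `d` that the Lipschitz hypothesis makes small in `L¹`. For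
`|g| > K` one inserts `(|g| / K) ^ δ ≥ 1` and bounds the resulting monomial of degree `2 + δ` by the
power of the larger factor. -/
lemma abs_mul_le_trunc {δ K d g : ℝ} (hδ : 0 < δ) (hK : 0 < K) :
    |d * g| ≤ K * |d| + K ^ (-δ) * (|d| ^ (2 + δ) + |g| ^ (2 + δ)) := by
  rw [abs_mul]
  have a1 : 0 ≤ K ^ (-δ) * (|d| ^ (2 + δ) + |g| ^ (2 + δ)) := by positivity
  rcases le_or_gt |g| K with h | h
  · nlinarith [abs_nonneg d]
  have hg : 0 < |g| := hK.trans h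
  have h1 : 1 ≤ K ^ (-δ) * |g| ^ δ := by
    rw [Real.rpow_neg hK.le, inv_mul_eq_div, one_le_div (by positivity)]
    gcongr
  have h2 : |d| * |g| * |g| ^ δ ≤ |d| ^ (2 + δ) + |g| ^ (2 + δ) := by
    rcases le_total |d| |g| with hl | hl
    · have : |d| * |g| * |g| ^ δ ≤ |g| ^ (2 + δ) := by
        rw [Real.rpow_add hg, Real.rpow_two]; gcongr; nlinarith
      have : 0 ≤ |d| ^ (2 + δ) := by positivity
      linarith
    · have hd : 0 < |d| := hg.trans_le hl
      have : |d| * |g| * |g| ^ δ ≤ |d| ^ (2 + δ) := by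
        rw [Real.rpow_add hd, Real.rpow_two]; gcongr; nlinarith
      have : 0 ≤ |g| ^ (2 + δ) := by positivity
      linarith
  have h3 : |d| * |g| ≤ K ^ (-δ) * (|d| * |g| * |g| ^ δ) := by
    have : 0 ≤ |d| * |g| := by positivity
    nlinarith
  have h4 : K ^ (-δ) * (|d| * |g| * |g| ^ δ) ≤ K ^ (-δ) * (|d| ^ (2 + δ) + |g| ^ (2 + δ)) := by
    gcongr
  have : 0 ≤ K * |d| := by positivity
  linarith

lemma abs_sub_rpow_le {q u w : ℝ} (hq : 0 < q) :
    |u - w| ^ q ≤ 2 ^ q * (|u| ^ q + |w| ^ q) := by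
  have h : |u - w| ≤ 2 * max |u| |w| := by
    have := abs_sub u w
    have := le_max_left |u| |w|
    have := le_max_right |u| |w|
    linarith
  have h0 : 0 ≤ max |u| |w| := (abs_nonneg u).trans (le_max_left _ _)
  calc _ ≤ (2 * max |u| |w|) ^ q := by gcongr
    _ = 2 ^ q * max |u| |w| ^ q := Real.mul_rpow (by norm_num) h0
    _ ≤ _ := by
      gcongr
      have a1 : 0 ≤ |u| ^ q := by positivity
      have a2 : 0 ≤ |w| ^ q := by positivity
      rcases max_choice |u| |w| with e | e <;> rw [e] <;> linarith

/-! ### The covariance estimate with free parameters. -/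

/-- The linear part of the Hoeffding decomposition inherits the Lipschitz property. -/
lemma IsPLipschitz.lintegral_hoeff1_le {Ω : Type*} [MeasurableSpace Ω] {X : ℕ → Ω → ℝ} {μ : Measure Ω} [IsProbabilityMeasure μ]
    (hX : ∀ n, Measurable (X n)) (hs : IsStationary X μ) {h : ℝ → ℝ → ℝ} {L : ℝ}
    (hL : IsPLipschitz X μ h L) {ε : ℝ} (hε : 0 < ε)
    (hh : Measurable (fun p : ℝ × ℝ => h p.1 p.2)) {F : Measure ℝ} (hF : μ.map (X 0) = F)
    (hhi : Integrable (fun p : ℝ × ℝ => h p.1 p.2) (F.prod F)) {Z : Type*} [MeasurableSpace Z]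
    (S : Measure Z) [IsFiniteMeasure S] {x x' : Z → ℝ} (hx : Measurable x) (hx' : Measurable x')
    (hS₁ : S.map x ≤ F) (hS₂ : S.map x' ≤ F) (hε' : ∀ᵐ z ∂S, |x z - x' z| ≤ ε) :
    ∫⁻ z, ENNReal.ofReal |hoeff1 F h (x z) - hoeff1 F h (x' z)| ∂S ≤ ENNReal.ofReal (L * ε) := by
  have : IsProbabilityMeasure F := hF ▸ Measure.isProbabilityMeasure_map (hX 0).aemeasurable
  have hmap : ∀ {y : Z → ℝ}, Measurable y → S.map y ≤ F →
      (S.prod F).map (fun p => (y p.1, p.2)) ≤ F.prod F := fun {y} hy hS => by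
    have e : (S.prod F).map (fun p => (y p.1, p.2)) = (S.map y).prod F := by
      have := Measure.map_prod_map S F hy (measurable_id (α := ℝ))
      rw [Measure.map_id] at this
      exact this.symm
    rw [e]
    exact Measure.prod_mono hS le_rfl
  have hmem : F.prod F ∈ pairLaws X μ := Or.inl (by rw [hF])
  -- An independent second coordinate with law `F` is adjoined to `S`, so both pairs are dominated
  -- by `F.prod F`.
  have key := hL.lintegral_le hX hs hε hmem hmem (S.prod F) (hx.comp measurable_fst)
    (hx'.comp measurable_fst) measurable_snd (hmap hx hS₁) (hmap hx' hS₂)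
    (Measure.ae_prod_mem_iff_ae_ae_mem (μ := S) (ν := F)
      (s := {p | |x p.1 - x' p.1| ≤ ε}) (measurableSet_le (by fun_prop) measurable_const) |>.2
      (hε'.mono fun z hz => ae_of_all _ fun _ => hz)) hh
  have hd : Measurable fun p : Z × ℝ => ENNReal.ofReal |h (x p.1) p.2 - h (x' p.1) p.2| := by
    have a1 : Measurable fun p : Z × ℝ => h (x p.1) p.2 :=
      hh.comp (g := fun p : ℝ × ℝ => h p.1 p.2) (f := fun p : Z × ℝ => (x p.1, p.2)) (by fun_prop)
    have a2 : Measurable fun p : Z × ℝ => h (x' p.1) p.2 :=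
      hh.comp (g := fun p : ℝ × ℝ => h p.1 p.2) (f := fun p : Z × ℝ => (x' p.1, p.2)) (by fun_prop)
    fun_prop
  refine le_trans ?_ key
  simp only [Function.comp_apply]
  rw [lintegral_prod _ hd.aemeasurable]
  have hsec : ∀ {y : Z → ℝ}, Measurable y → S.map y ≤ F → ∀ᵐ z ∂S, Integrable (h (y z)) F :=
    fun hy hS => ae_of_ae_map hy.aemeasurable
      ((Measure.absolutelyContinuous_of_le hS).ae_le hhi.prod_right_ae)
  refine lintegral_mono_ae ?_
  filter_upwards [hsec hx hS₁, hsec hx' hS₂] with z h1 h2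
  have e : hoeff1 F h (x z) - hoeff1 F h (x' z) = ∫ y, (h (x z) y - h (x' z) y) ∂F := by
    rw [integral_sub h1 h2]; simp [hoeff1]
  rw [e, ← Real.norm_eq_abs, ofReal_norm]
  refine (enorm_integral_le_lintegral_enorm _).trans_eq (lintegral_congr fun y => ?_)
  rw [← ofReal_norm, Real.norm_eq_abs]

lemma lintegral_mul_rpow_le {T : Type*} [MeasurableSpace T] {P : Measure T} {u g : T → ℝ}
    (hu : Measurable u) {δ C : ℝ} (hδ : 0 < δ) (hC : 0 ≤ C)
    (h₁ : ∫⁻ t, ENNReal.ofReal (|u t| ^ (2 + δ)) ∂P ≤ ENNReal.ofReal C)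
    (h₂ : ∫⁻ t, ENNReal.ofReal (|g t| ^ (2 + δ)) ∂P ≤ ENNReal.ofReal C) :
    ∫⁻ t, ENNReal.ofReal (|u t * g t| ^ (1 + δ / 2)) ∂P ≤ ENNReal.ofReal (2 * C) := by
  calc _ ≤ ∫⁻ t, (ENNReal.ofReal (|u t| ^ (2 + δ)) + ENNReal.ofReal (|g t| ^ (2 + δ))) ∂P := by
        refine lintegral_mono fun t => ?_
        dsimp only
        rw [← ENNReal.ofReal_add (by positivity) (by positivity)]
        exact ENNReal.ofReal_le_ofReal (abs_mul_rpow_le hδ)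
    _ ≤ ENNReal.ofReal C + ENNReal.ofReal C := by
        rw [lintegral_add_left (by fun_prop)]; exact add_le_add h₁ h₂
    _ = _ := by rw [← ENNReal.ofReal_add hC hC, two_mul]

lemma lintegral_truncation {T : Type*} [MeasurableSpace T] {P : Measure T}
    {u₁ u₂ u₃ u₄ u₅ : T → ENNReal} (h₁ : Measurable u₁) (h₂ : Measurable u₂) (h₃ : Measurable u₃)
    (h₄ : Measurable u₄) (h₅ : Measurable u₅) {k₁ k₂ k₃ : ENNReal} :
    ∫⁻ t, (k₁ * (u₁ t + u₂ t) + k₂ * (k₃ * (u₃ t + u₄ t) + u₅ t)) ∂P =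
      k₁ * (∫⁻ t, u₁ t ∂P + ∫⁻ t, u₂ t ∂P) +
        k₂ * (k₃ * (∫⁻ t, u₃ t ∂P + ∫⁻ t, u₄ t ∂P) + ∫⁻ t, u₅ t ∂P) := by
  rw [lintegral_add_left (by fun_prop), lintegral_const_mul _ (by fun_prop),
    lintegral_add_left (by fun_prop), lintegral_const_mul _ (by fun_prop),
    lintegral_add_left (by fun_prop), lintegral_const_mul _ (by fun_prop),
    lintegral_add_left (by fun_prop)]

/-- The basic covariance estimate, with free truncation levels `A` and `K` and a free
discretization. -/
lemma abs_integral_hoeff2_mul_le {Ω : Type*} {m : MeasurableSpace Ω} [mΩ : MeasurableSpace Ω]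
    (hm : m ≤ mΩ) {X : ℕ → Ω → ℝ} {μ : Measure Ω} [IsProbabilityMeasure μ]
    (hX : ∀ n, Measurable (X n)) (hs : IsStationary X μ) {h : ℝ → ℝ → ℝ} {L : ℝ}
    (hL : IsPLipschitz X μ h L) (hh : Measurable (fun p : ℝ × ℝ => h p.1 p.2))
    (hsym : ∀ x y, h x y = h y x) {F : Measure ℝ} (hF : μ.map (X 0) = F)
    (hhi : Integrable (fun p : ℝ × ℝ => h p.1 p.2) (F.prod F))
    {V Y G : Ω → ℝ} (hV : Measurable V)
    (hY : Measurable[m] Y) (hG : Measurable[m] G) (hVF : μ.map V = F) (hYF : μ.map Y = F)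
    (hVY : μ.map (fun ω => (V ω, Y ω)) ∈ pairLaws X μ ∨ μ.map (fun ω => (Y ω, V ω)) ∈ pairLaws X μ)
    {δ C : ℝ} (hδ : 0 < δ) (hC : 0 ≤ C)
    (hm₁ : ∫⁻ ω, ENNReal.ofReal (|hoeff2 F h (V ω) (Y ω)| ^ (2 + δ)) ∂μ ≤ ENNReal.ofReal C)
    (hm₂ : ∫⁻ ω, ENNReal.ofReal (|G ω| ^ (2 + δ)) ∂μ ≤ ENNReal.ofReal C)
    (hm₃ : ∫⁻ p : ℝ × ℝ, ENNReal.ofReal (|hoeff2 F h p.1 p.2| ^ (2 + δ)) ∂(F.prod F) ≤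
      ENNReal.ofReal C)
    {a : ℝ} (ha : ∀ A : Set ℝ, MeasurableSet A → ∀ B, MeasurableSet[m] B →
      |μ.real (V ⁻¹' A ∩ B) - μ.real (V ⁻¹' A) * μ.real B| ≤ a)
    {ε : ℝ} (hε : 0 < ε) (J : Finset ℤ) {A K : ℝ} (hA : 0 < A) (hK : 0 < K) {r : ℝ}
    (hr : F.real {x | ⌊x / ε⌋ ∉ J} + 32 / 3 * √J.card * a ≤ r) :
    |∫ ω, hoeff2 F h (V ω) (Y ω) * G ω ∂μ| ≤
      2 * (A * (2 * r) + A ^ (-(δ / 2)) * (2 * C)) +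
        (K * (4 * (L * ε)) + K ^ (-δ) * (2 ^ (2 + δ) * (2 * C) + C)) := by
  have hFp : IsProbabilityMeasure F := hF ▸ Measure.isProbabilityMeasure_map (hX 0).aemeasurable
  have hY' : Measurable Y := hY.mono hm le_rfl
  have hG' : Measurable G := hG.mono hm le_rfl
  have hWm : Measurable[m] fun ω => (Y ω, G ω) := hY.prodMk hG
  have hW' : Measurable fun ω => (Y ω, G ω) := hY'.prodMk hG'
  have hWp : IsProbabilityMeasure (μ.map fun ω => (Y ω, G ω)) :=
    Measure.isProbabilityMeasure_map hW'.aemeasurable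
  have ha0 : 0 ≤ a := (abs_nonneg _).trans (ha ∅ MeasurableSet.empty ∅ (@MeasurableSet.empty _ m))
  have hr0 : 0 ≤ r := le_trans (by positivity) hr
  have hL0 : 0 < L := hL.1
  have hq : 0 < 2 + δ := by linarith
  have h2m := measurable_hoeff2 (F := F) hh
  have h2c : ∀ {T : Type _} [MeasurableSpace T] {x y : T → ℝ}, Measurable x → Measurable y →
      Measurable fun t => hoeff2 F h (x t) (y t) := fun hx hy => h2m.comp (hx.prodMk hy)
  have hc : Measurable fun x : ℝ => ⌊x / ε⌋ := Int.measurable_floor.comp (measurable_id.div_const ε)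
  obtain ⟨S, s₁, s₂, s₃, s₄, s₅, s₆⟩ := exists_double_subcoupling hm μ hV hY hWm hVF hYF ha hc J
  have hSfin : IsFiniteMeasure S := ⟨by
    have := s₁ Set.univ
    rw [Measure.map_apply measurable_fst MeasurableSet.univ, Set.preimage_univ] at this
    exact this.trans_lt (measure_lt_top _ _)⟩
  have hfloor : ∀ x y : ℝ, ⌊x / ε⌋ = ⌊y / ε⌋ → |x - y| ≤ ε := fun x y hxy => by
    have := (Int.abs_sub_lt_one_of_floor_eq_floor hxy).le
    rwa [← sub_div, abs_div, abs_of_pos hε, div_le_one hε] at this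
  -- marginals of the sub-coupling
  have hmapW : ∀ {T : Type _} [MeasurableSpace T] {φ : Ω → T}, Measurable φ →
      S.map (fun z => φ z.1) ≤ μ.map φ := fun {T _ φ} hφ => by
    have := Measure.map_mono s₁ hφ
    rwa [Measure.map_map hφ measurable_fst] at this
  set P₂ := (μ.map fun ω => (Y ω, G ω)).prod F with hP₂
  have hP₂F : P₂.map (fun p : (ℝ × ℝ) × ℝ => (p.1.1, p.2)) = F.prod F := by
    have e := Measure.map_prod_map (μ.map fun ω => (Y ω, G ω)) F measurable_fst
      (measurable_id (α := ℝ))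
    rw [Measure.map_id, Measure.map_map measurable_fst hW'] at e
    rw [show μ.map (Prod.fst ∘ fun ω => (Y ω, G ω)) = F from hYF] at e
    exact e.symm
  have t₂ : S.map (fun z => (Y z.1, z.2.1)) ≤ F.prod F := by
    have := Measure.map_mono s₂ (f := fun p : (ℝ × ℝ) × ℝ => (p.1.1, p.2)) (by fun_prop)
    rw [Measure.map_map (by fun_prop) (by fun_prop)] at this
    exact this.trans_eq hP₂F
  have hswap : ∀ {x y : Ω × ℝ × ℝ → ℝ}, Measurable x → Measurable y →
      S.map (fun z => (x z, y z)) ≤ F.prod F → S.map (fun z => (y z, x z)) ≤ F.prod F :=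
    fun {x y} hx hy hS => by
      have := Measure.map_mono hS measurable_swap
      rw [Measure.map_map measurable_swap (hx.prodMk hy), Measure.prod_swap] at this
      exact this
  have hSV : S.map (fun z => V z.1) ≤ F := hVF ▸ hmapW hV
  have hSv : S.map (fun z => z.2.1) ≤ F := by
    have := Measure.map_mono t₂ measurable_snd
    rw [Measure.map_map measurable_snd (by fun_prop)] at this
    exact this.trans_eq Measure.snd_prod
  have hFF : F.prod F ∈ pairLaws X μ := Or.inl (by rw [hF])
  have c₁ : ∀ᵐ z ∂S, |V z.1 - z.2.1| ≤ ε := s₅.mono fun z hz => hfloor _ _ hz.1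
  have c₂ : ∀ᵐ z ∂S, |Y z.1 - z.2.2| ≤ ε := s₅.mono fun z hz => hfloor _ _ hz.2
  have c₂' : ∀ᵐ z ∂S, |z.2.2 - Y z.1| ≤ ε := c₂.mono fun z hz => by rwa [abs_sub_comm]
  have hVz : Measurable fun z : Ω × ℝ × ℝ => V z.1 := hV.comp measurable_fst
  have hYz : Measurable fun z : Ω × ℝ × ℝ => Y z.1 := hY'.comp measurable_fst
  have hGz : Measurable fun z : Ω × ℝ × ℝ => G z.1 := hG'.comp measurable_fst
  have hvz : Measurable fun z : Ω × ℝ × ℝ => z.2.1 := by fun_prop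
  have hyz : Measurable fun z : Ω × ℝ × ℝ => z.2.2 := by fun_prop
  have hhc : ∀ {x y : Ω × ℝ × ℝ → ℝ}, Measurable x → Measurable y →
      Measurable fun t => h (x t) (y t) := fun hx hy => hh.comp (hx.prodMk hy)
  -- the Lipschitz estimate for `h`
  have leg : ∫⁻ z, ENNReal.ofReal |h (V z.1) (Y z.1) - h z.2.1 (Y z.1)| ∂S ≤
      ENNReal.ofReal (3 * (L * ε)) := by
    rcases hVY with hVY | hYV
    · refine (hL.lintegral_le hX hs hε hVY hFF S hVz hvz hYz (hmapW (hV.prodMk hY'))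
        (hswap hYz hvz t₂) c₁ hh).trans (ENNReal.ofReal_le_ofReal ?_)
      have : 0 < L * ε := by positivity
      linarith
    · have l₁ := hL.lintegral_le hX hs hε hYV hFF S hYz hyz hVz (hmapW (hY'.prodMk hV))
        (hswap hVz hyz s₃) c₂ hh
      have l₂ := hL.lintegral_le hX hs hε hFF hFF S hVz hvz hyz s₃ s₄ c₁ hh
      have l₃ := hL.lintegral_le hX hs hε hFF hFF S hyz hYz hvz (hswap hvz hyz s₄) t₂ c₂' hh
      calc _ ≤ ∫⁻ z, (ENNReal.ofReal |h (Y z.1) (V z.1) - h z.2.2 (V z.1)| +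
            ENNReal.ofReal |h (V z.1) z.2.2 - h z.2.1 z.2.2| +
            ENNReal.ofReal |h z.2.2 z.2.1 - h (Y z.1) z.2.1|) ∂S := by
            refine lintegral_mono fun z => ?_
            dsimp only
            rw [← ENNReal.ofReal_add (abs_nonneg _) (abs_nonneg _),
              ← ENNReal.ofReal_add (by positivity) (abs_nonneg _)]
            refine ENNReal.ofReal_le_ofReal ?_
            have e : h (V z.1) (Y z.1) - h z.2.1 (Y z.1) = (h (Y z.1) (V z.1) - h z.2.2 (V z.1)) +
                (h (V z.1) z.2.2 - h z.2.1 z.2.2) + (h z.2.2 z.2.1 - h (Y z.1) z.2.1) := by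
              rw [hsym (Y z.1) (V z.1), hsym z.2.2 (V z.1), hsym z.2.2 z.2.1, hsym (Y z.1) z.2.1]
              ring
            rw [e]
            exact abs_add_three _ _ _
        _ ≤ ENNReal.ofReal (L * ε) + ENNReal.ofReal (L * ε) + ENNReal.ofReal (L * ε) := by
            rw [lintegral_add_left, lintegral_add_left]
            · gcongr
            · exact ((hhc hYz hVz).sub (hhc hyz hVz)).abs.ennreal_ofReal
            · exact ((hhc hYz hVz).sub (hhc hyz hVz)).abs.ennreal_ofReal.add
                ((hhc hVz hyz).sub (hhc hvz hyz)).abs.ennreal_ofReal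
        _ = _ := by
            rw [← ENNReal.ofReal_add (by positivity) (by positivity),
              ← ENNReal.ofReal_add (by positivity) (by positivity)]
            ring_nf
  have leg₁ := hL.lintegral_hoeff1_le hX hs hε hh hF hhi S hVz hvz hSV hSv c₁
  -- moments under the sub-coupling
  have hpow : Measurable fun x : ℝ => ENNReal.ofReal (|x| ^ (2 + δ)) := by fun_prop
  have n₁ : ∫⁻ z, ENNReal.ofReal (|hoeff2 F h (V z.1) (Y z.1)| ^ (2 + δ)) ∂S ≤
      ENNReal.ofReal C := by
    rw [← lintegral_map (f := fun ω => ENNReal.ofReal (|hoeff2 F h (V ω) (Y ω)| ^ (2 + δ)))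
      (hpow.comp (h2c hV hY')) measurable_fst]
    exact (lintegral_mono' s₁ le_rfl).trans hm₁
  have n₂ : ∫⁻ z, ENNReal.ofReal (|G z.1| ^ (2 + δ)) ∂S ≤ ENNReal.ofReal C := by
    rw [← lintegral_map (f := fun ω => ENNReal.ofReal (|G ω| ^ (2 + δ)))
      (hpow.comp hG') measurable_fst]
    exact (lintegral_mono' s₁ le_rfl).trans hm₂
  have n₃ : ∫⁻ z, ENNReal.ofReal (|hoeff2 F h z.2.1 (Y z.1)| ^ (2 + δ)) ∂S ≤
      ENNReal.ofReal C := by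
    rw [← lintegral_map (f := fun p : ℝ × ℝ => ENNReal.ofReal (|hoeff2 F h p.1 p.2| ^ (2 + δ)))
      (g := fun z : Ω × ℝ × ℝ => (z.2.1, Y z.1)) (hpow.comp h2m) (hvz.prodMk hYz)]
    exact (lintegral_mono' (hswap hYz hvz t₂) le_rfl).trans hm₃
  have mid : ∫⁻ z, ENNReal.ofReal |(hoeff2 F h (V z.1) (Y z.1) - hoeff2 F h z.2.1 (Y z.1)) * G z.1|
      ∂S ≤ ENNReal.ofReal (K * (4 * (L * ε)) + K ^ (-δ) * (2 ^ (2 + δ) * (2 * C) + C)) := by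
    have u₁ : Measurable fun z : Ω × ℝ × ℝ => ENNReal.ofReal |h (V z.1) (Y z.1) - h z.2.1 (Y z.1)| :=
      ((hhc hVz hYz).sub (hhc hvz hYz)).abs.ennreal_ofReal
    have h1m := measurable_hoeff1 (F := F) hh
    have u₂ : Measurable fun z : Ω × ℝ × ℝ =>
        ENNReal.ofReal |hoeff1 F h (V z.1) - hoeff1 F h z.2.1| :=
      ((h1m.comp hVz).sub (h1m.comp hvz)).abs.ennreal_ofReal
    have u₃ := hpow.comp (h2c hVz hYz)
    have u₄ := hpow.comp (h2c hvz hYz)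
    have u₅ := hpow.comp hGz
    simp only [Function.comp_def] at u₃ u₄ u₅
    calc _ ≤ ∫⁻ z, (ENNReal.ofReal K * (ENNReal.ofReal |h (V z.1) (Y z.1) - h z.2.1 (Y z.1)| +
            ENNReal.ofReal |hoeff1 F h (V z.1) - hoeff1 F h z.2.1|) +
          ENNReal.ofReal (K ^ (-δ)) * (ENNReal.ofReal (2 ^ (2 + δ)) *
            (ENNReal.ofReal (|hoeff2 F h (V z.1) (Y z.1)| ^ (2 + δ)) +
              ENNReal.ofReal (|hoeff2 F h z.2.1 (Y z.1)| ^ (2 + δ))) +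
            ENNReal.ofReal (|G z.1| ^ (2 + δ)))) ∂S := by
          refine lintegral_mono fun z => ?_
          dsimp only
          rw [← ENNReal.ofReal_add (by positivity) (by positivity),
            ← ENNReal.ofReal_add (by positivity) (by positivity),
            ← ENNReal.ofReal_mul (by positivity), ← ENNReal.ofReal_mul (by positivity),
            ← ENNReal.ofReal_add (by positivity) (by positivity),
            ← ENNReal.ofReal_mul (by positivity),
            ← ENNReal.ofReal_add (by positivity) (by positivity)]
          refine ENNReal.ofReal_le_ofReal ((abs_mul_le_trunc hδ hK).trans ?_)
          gcongr
          -- The terms `hoeff1 F h (Y z.1)` and `theta F h` cancel, leaving `3 * (L * ε)` from `h`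
          -- and `L * ε` from `hoeff1`.
          · have e : hoeff2 F h (V z.1) (Y z.1) - hoeff2 F h z.2.1 (Y z.1) =
                (h (V z.1) (Y z.1) - h z.2.1 (Y z.1)) -
                  (hoeff1 F h (V z.1) - hoeff1 F h z.2.1) := by
              simp only [hoeff2]; ring
            rw [e]
            exact abs_sub _ _
          · exact abs_sub_rpow_le hq
      _ ≤ ENNReal.ofReal K * (ENNReal.ofReal (3 * (L * ε)) + ENNReal.ofReal (L * ε)) +
          ENNReal.ofReal (K ^ (-δ)) * (ENNReal.ofReal (2 ^ (2 + δ)) *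
            (ENNReal.ofReal C + ENNReal.ofReal C) + ENNReal.ofReal C) := by
          rw [lintegral_truncation u₁ u₂ u₃ u₄ u₅]
          gcongr
      _ = _ := by
          rw [← ENNReal.ofReal_add (by positivity) (by positivity),
            ← ENNReal.ofReal_add (by positivity) (by positivity),
            ← ENNReal.ofReal_mul (by positivity), ← ENNReal.ofReal_mul (by positivity),
            ← ENNReal.ofReal_add (by positivity) (by positivity),
            ← ENNReal.ofReal_mul (by positivity),
            ← ENNReal.ofReal_add (by positivity) (by positivity)]
          ring_nf
  -- the two remainders
  set f₁ : Ω → ℝ := fun ω => hoeff2 F h (V ω) (Y ω) * G ω with hf₁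
  set f₂ : (ℝ × ℝ) × ℝ → ℝ := fun p => hoeff2 F h p.2 p.1.1 * p.1.2 with hf₂
  have hf₁m : Measurable f₁ := (h2c hV hY').mul hG'
  have hf₂u : Measurable fun p : (ℝ × ℝ) × ℝ => hoeff2 F h p.2 p.1.1 :=
    h2m.comp (g := fun p : ℝ × ℝ => hoeff2 F h p.1 p.2)
      (f := fun p : (ℝ × ℝ) × ℝ => (p.2, p.1.1)) (by fun_prop)
  have hf₂m : Measurable f₂ := hf₂u.mul (by fun_prop)
  have m₁ := lintegral_mul_rpow_le (h2c hV hY') hδ hC hm₁ hm₂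
  have m₂ : ∫⁻ p, ENNReal.ofReal (|f₂ p| ^ (1 + δ / 2)) ∂P₂ ≤ ENNReal.ofReal (2 * C) := by
    refine lintegral_mul_rpow_le hf₂u hδ hC ?_ ?_
    · rw [← Measure.prod_swap, ← hP₂F, Measure.map_map measurable_swap (by fun_prop),
        lintegral_map (f := fun p : ℝ × ℝ => ENNReal.ofReal (|hoeff2 F h p.1 p.2| ^ (2 + δ)))
          (hpow.comp h2m) (by fun_prop)] at hm₃
      exact hm₃
    · have e : P₂.map Prod.fst = μ.map fun ω => (Y ω, G ω) := Measure.fst_prod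
      have e' : P₂.map (fun p => p.1.2) = μ.map G := by
        have := congrArg (fun ν => ν.map Prod.snd) e
        rwa [Measure.map_map measurable_snd measurable_fst,
          Measure.map_map measurable_snd hW'] at this
      rw [← lintegral_map (f := fun x => ENNReal.ofReal (|x| ^ (2 + δ))) hpow (by fun_prop), e',
        lintegral_map hpow hG']
      exact hm₂
  have i₁ : Integrable f₁ μ := integrable_of_lintegral_rpow_le hf₁m (by linarith) m₁
  have i₂ : Integrable f₂ P₂ := integrable_of_lintegral_rpow_le hf₂m (by linarith) m₂
  -- Degeneracy enters here: under `P₂` the copy of `V` is independent of `(Y, G)`, so integrating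
  -- it out first gives zero for almost every `Y`.
  have z₂ : ∫ p, f₂ p ∂P₂ = 0 := by
    rw [hP₂, integral_prod _ i₂]
    refine integral_eq_zero_of_ae ?_
    have h0 := ae_integral_hoeff2_eq_zero hhi hsym
    rw [← hYF] at h0
    have h0' := ae_of_ae_map hY'.aemeasurable h0
    rw [hYF] at h0'
    refine (ae_map_iff hW'.aemeasurable ?_).2 (h0'.mono fun ω hω => ?_)
    · exact measurableSet_eq_fun
        (hf₂m.stronglyMeasurable.integral_prod_right' (ν := F)).measurable measurable_const
    · simp only [hf₂, integral_mul_const, hω, zero_mul, Pi.zero_apply]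
  have hmass : ∀ {T : Type _} [MeasurableSpace T] {φ : Ω × ℝ × ℝ → T}, Measurable φ →
      1 ≤ S.map φ Set.univ + ENNReal.ofReal (2 * r) := fun {T _ φ} hφ => by
    rw [Measure.map_apply hφ MeasurableSet.univ, Set.preimage_univ]
    refine s₆.trans (add_le_add_right (ENNReal.ofReal_le_ofReal ?_) _)
    linarith
  have r₁ := abs_integral_sub_integral_le s₁ hf₁m i₁ hδ hA (r := 2 * r) (by positivity)
    (by positivity) m₁ (by
      rw [Measure.map_apply measurable_fst MeasurableSet.univ, Set.preimage_univ]
      refine s₆.trans (add_le_add_right (ENNReal.ofReal_le_ofReal ?_) _)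
      linarith)
  have r₂ := abs_integral_sub_integral_le s₂ hf₂m i₂ hδ hA (r := 2 * r) (by positivity)
    (by positivity) m₂ (hmass (hW'.comp measurable_fst |>.prodMk hvz))
  have hWz : Measurable fun z : Ω × ℝ × ℝ => ((Y z.1, G z.1), z.2.1) := (hYz.prodMk hGz).prodMk hvz
  have j₁ : Integrable (fun z : Ω × ℝ × ℝ => f₁ z.1) S :=
    (integrable_map_measure hf₁m.aestronglyMeasurable measurable_fst.aemeasurable).1
      (i₁.mono_measure s₁)
  have j₂ : Integrable (fun z : Ω × ℝ × ℝ => f₂ ((Y z.1, G z.1), z.2.1)) S :=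
    (integrable_map_measure hf₂m.aestronglyMeasurable hWz.aemeasurable).1
      (i₂.mono_measure s₂)
  rw [integral_map measurable_fst.aemeasurable hf₁m.aestronglyMeasurable] at r₁
  rw [integral_map hWz.aemeasurable hf₂m.aestronglyMeasurable, z₂] at r₂
  have r₃ : |∫ z, f₁ z.1 ∂S - ∫ z, f₂ ((Y z.1, G z.1), z.2.1) ∂S| ≤
      K * (4 * (L * ε)) + K ^ (-δ) * (2 ^ (2 + δ) * (2 * C) + C) := by
    rw [← integral_sub j₁ j₂, ← ENNReal.ofReal_le_ofReal_iff (by positivity), ← Real.norm_eq_abs,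
      ofReal_norm]
    refine (enorm_integral_le_lintegral_enorm _).trans (le_of_eq_of_le ?_ mid)
    refine lintegral_congr fun z => ?_
    rw [← ofReal_norm, Real.norm_eq_abs, sub_mul]
  have b₁ := abs_le.1 r₁
  have b₂ := abs_le.1 r₂
  have b₃ := abs_le.1 r₃
  exact abs_le.2 ⟨by linarith, by linarith⟩

/-! ### Elementary properties of the mixing coefficients. -/

lemma abs_measureReal_inter_sub_le_one {Ω : Type*} [MeasurableSpace Ω] (μ : Measure Ω)
    [IsProbabilityMeasure μ] (A B : Set Ω) :
    |μ.real (A ∩ B) - μ.real A * μ.real B| ≤ 1 := by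
  have h1 : μ.real (A ∩ B) ≤ 1 := measureReal_le_one
  have h2 : μ.real A ≤ 1 := measureReal_le_one
  have h3 : μ.real B ≤ 1 := measureReal_le_one
  have h1' : 0 ≤ μ.real (A ∩ B) := measureReal_nonneg
  have h2' : 0 ≤ μ.real A := measureReal_nonneg
  have h3' : 0 ≤ μ.real B := measureReal_nonneg
  exact abs_le.2 ⟨by nlinarith, by nlinarith⟩

lemma alphaCoeff_bddAbove {Ω : Type*} (𝓐 𝓑 : MeasurableSpace Ω) [mΩ : MeasurableSpace Ω]
    (μ : Measure Ω) [IsProbabilityMeasure μ] :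
    BddAbove {r : ℝ | ∃ A B : Set Ω, MeasurableSet[𝓐] A ∧ MeasurableSet[𝓑] B ∧
      r = |μ.real (A ∩ B) - μ.real A * μ.real B|} :=
  ⟨1, by rintro _ ⟨A, B, _, _, rfl⟩; exact abs_measureReal_inter_sub_le_one μ A B⟩

lemma alphaCoeff_le_one {Ω : Type*} (𝓐 𝓑 : MeasurableSpace Ω) [mΩ : MeasurableSpace Ω]
    (μ : Measure Ω) [IsProbabilityMeasure μ] : alphaCoeff μ 𝓐 𝓑 ≤ 1 := by
  refine Real.sSup_le ?_ zero_le_one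
  rintro _ ⟨A, B, _, _, rfl⟩
  exact abs_measureReal_inter_sub_le_one μ A B

section Mixing

variable {Ω : Type*} [MeasurableSpace Ω] {μ : Measure Ω} [IsProbabilityMeasure μ]

lemma alphaMix_le_one (X : ℕ → Ω → ℝ) (n : ℕ) : alphaMix X μ n ≤ 1 :=
  ciSup_le fun _ => alphaCoeff_le_one _ _ μ

lemma abs_sub_le_alphaMix (X : ℕ → Ω → ℝ) (k n : ℕ) {A B : Set Ω}
    (hA : MeasurableSet[sigmaGen X (Set.Iic k)] A)
    (hB : MeasurableSet[sigmaGen X (Set.Ici (k + n))] B) :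
    |μ.real (A ∩ B) - μ.real A * μ.real B| ≤ alphaMix X μ n := by
  have h1 : |μ.real (A ∩ B) - μ.real A * μ.real B| ≤
      alphaCoeff μ (sigmaGen X (Set.Iic k)) (sigmaGen X (Set.Ici (k + n))) :=
    le_csSup (alphaCoeff_bddAbove _ _ μ) ⟨A, B, hA, hB, rfl⟩
  exact h1.trans (le_ciSup
    (f := fun k => alphaCoeff μ (sigmaGen X (Set.Iic k)) (sigmaGen X (Set.Ici (k + n))))
    ⟨1, by rintro _ ⟨k, rfl⟩; exact alphaCoeff_le_one _ _ μ⟩ k)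

lemma sigmaGen_le {X : ℕ → Ω → ℝ} (hX : ∀ n, Measurable (X n)) (I : Set ℕ) :
    sigmaGen X I ≤ ‹MeasurableSpace Ω› :=
  iSup₂_le fun i _ => (hX i).comap_le

end Mixing

lemma measurable_sigmaGen {Ω : Type*} {X : ℕ → Ω → ℝ} {I : Set ℕ} {i : ℕ} (hi : i ∈ I) :
    Measurable[sigmaGen X I] (X i) :=
  (comap_measurable (X i)).mono
    (le_iSup₂ (f := fun i (_ : i ∈ I) => MeasurableSpace.comap (X i) inferInstance) i hi) le_rfl

/-! ### Choice of scale and the resulting rate. -/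

/-- Markov's inequality for the cells far away from the origin. -/
lemma measureReal_floor_notMem_le {F : Measure ℝ} [IsProbabilityMeasure F] {γ : ℝ} (hγ : 0 < γ)
    (hF : Integrable (fun x => |x| ^ γ) F) {ε : ℝ} (hε : 0 < ε) {n : ℕ} (hn : 0 < n) :
    F.real {x | ⌊x / ε⌋ ∉ Finset.Ico (-(n : ℤ)) n} ≤ (∫ x, |x| ^ γ ∂F) * (n * ε) ^ (-γ) := by
  have hnε : 0 < (n : ℝ) * ε := by positivity
  have hsub : {x | ⌊x / ε⌋ ∉ Finset.Ico (-(n : ℤ)) n} ⊆ {x | (n * ε) ^ γ ≤ |x| ^ γ} := by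
    intro x hx
    simp only [Finset.mem_Ico, not_and_or, not_le, not_lt, Set.mem_ofPred_eq] at hx ⊢
    gcongr
    rcases hx with hx | hx
    · rw [Int.floor_lt, div_lt_iff₀ hε] at hx
      push_cast at hx
      rw [le_abs]; right; linarith
    · rw [Int.le_floor, le_div_iff₀ hε] at hx
      push_cast at hx
      rw [le_abs]; left; linarith
  have hM := mul_meas_ge_le_integral_of_nonneg (μ := F) (ae_of_all _ fun x => by positivity) hF
    ((n * ε) ^ γ)
  rw [Real.rpow_neg hnε.le, ← div_eq_mul_inv, le_div_iff₀ (by positivity), mul_comm]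
  refine le_trans ?_ hM
  gcongr
  exact measure_ne_top _ _

/-- The optimal discretization: with `b` the common scale, the mass lost by the coupling is of order
`b ^ (2 + δ)`. -/
lemma exists_discretization {F : Measure ℝ} [IsProbabilityMeasure F] {γ δ : ℝ} (hγ : 0 < γ)
    (hδ : 0 < δ) (hF : Integrable (fun x => |x| ^ γ) F) {b : ℝ} (hb : 0 < b) (hb1 : b ≤ 1) :
    ∃ J : Finset ℤ, F.real {x | ⌊x / b ^ (1 + δ)⌋ ∉ J} +
      32 / 3 * √J.card * b ^ ((3 * γ * δ + δ + 5 * γ + 2) / (2 * γ)) ≤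
        ((∫ x, |x| ^ γ ∂F) + 64 / 3) * b ^ (2 + δ) := by
  -- Chosen so that `t * b ^ (1 + δ) = b ^ (-(2 + δ) / γ)`, for which Markov's inequality gives a
  -- tail of order `b ^ (2 + δ)`. Since `t ≥ 1`, rounding up at most doubles it.
  set t : ℝ := b ^ (-((2 + δ) / γ + (1 + δ))) with ht
  have ht1 : 1 ≤ t := Real.one_le_rpow_of_pos_of_le_one_of_nonpos hb hb1
    (by have : 0 < (2 + δ) / γ := by positivity
        linarith)
  set n := ⌈t⌉₊ with hn
  have hn1 : t ≤ n := Nat.le_ceil t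
  have hn2 : (n : ℝ) ≤ 2 * t := by
    have := (Nat.ceil_lt_add_one (by linarith : (0 : ℝ) ≤ t)).le
    linarith
  have hnpos : 0 < n := Nat.ceil_pos.2 (by linarith)
  have hm0 : 0 ≤ ∫ x, |x| ^ γ ∂F := integral_nonneg fun x => by positivity
  refine ⟨Finset.Ico (-(n : ℤ)) n, ?_⟩
  rw [add_mul]
  refine add_le_add ((measureReal_floor_notMem_le hγ hF (by positivity) hnpos).trans ?_) ?_
  · gcongr
    calc ((n : ℝ) * b ^ (1 + δ)) ^ (-γ) ≤ (t * b ^ (1 + δ)) ^ (-γ) :=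
          Real.rpow_le_rpow_of_nonpos (by positivity) (by gcongr) (by linarith)
      _ = b ^ (2 + δ) := by
          rw [ht, ← Real.rpow_add hb, ← Real.rpow_mul hb.le]
          congr 1; field_simp; ring
  · have hcard : ((Finset.Ico (-(n : ℤ)) n).card : ℝ) ≤ 4 * t := by
      rw [Int.card_Ico]
      have : ((n : ℤ) - -(n : ℤ)).toNat = 2 * n := by omega
      rw [this]; push_cast; linarith
    have hsq : √(Finset.Ico (-(n : ℤ)) n).card ≤ 2 * t ^ (1 / 2 : ℝ) := by
      refine (Real.sqrt_le_sqrt hcard).trans_eq ?_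
      rw [Real.sqrt_mul (by norm_num), Real.sqrt_eq_rpow t,
        show (4 : ℝ) = 2 ^ 2 by norm_num, Real.sqrt_sq (by norm_num)]
    calc _ ≤ 32 / 3 * (2 * t ^ (1 / 2 : ℝ)) * b ^ ((3 * γ * δ + δ + 5 * γ + 2) / (2 * γ)) := by
          gcongr
      _ = 64 / 3 * (t ^ (1 / 2 : ℝ) * b ^ ((3 * γ * δ + δ + 5 * γ + 2) / (2 * γ))) := by ring
      _ = _ := by
          rw [ht, ← Real.rpow_mul hb.le, ← Real.rpow_add hb]
          congr 2; field_simp; ring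

/-- The constant of the covariance inequality. -/
def covConst (γ N δ M L : ℝ) : ℝ :=
  4 * (N ^ γ + 64 / 3) + 4 * (4 ^ (2 + δ) * M) + 4 * L +
    (2 ^ (2 + δ) * (2 * (4 ^ (2 + δ) * M)) + 4 ^ (2 + δ) * M)

section Cov

variable {Ω : Type*} {m : MeasurableSpace Ω} [mΩ : MeasurableSpace Ω]

/-- Stationarity moves the earlier index to `0`, and symmetry of `h` covers pairs in reversed order.
-/
lemma lintegral_hoeff2_pair_le {X : ℕ → Ω → ℝ} {μ : Measure Ω} [IsProbabilityMeasure μ]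
    (hX : ∀ n, Measurable (X n)) (hs : IsStationary X μ) {h : ℝ → ℝ → ℝ}
    (hh : Measurable (fun p : ℝ × ℝ => h p.1 p.2)) (hsym : ∀ x y, h x y = h y x) {q M : ℝ}
    (hq : 1 ≤ q)
    (hM₁ : ∫⁻ p : ℝ × ℝ, ENNReal.ofReal (|h p.1 p.2| ^ q)
      ∂((μ.map (X 0)).prod (μ.map (X 0))) ≤ ENNReal.ofReal M)
    (hM₂ : ∀ k : ℕ, ∫⁻ ω, ENNReal.ofReal (|h (X 0 ω) (X k ω)| ^ q) ∂μ ≤ ENNReal.ofReal M)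
    (i j : ℕ) :
    ∫⁻ ω, ENNReal.ofReal (|hoeff2 (μ.map (X 0)) h (X i ω) (X j ω)| ^ q) ∂μ ≤
      ENNReal.ofReal (4 ^ q * M) := by
  have : IsProbabilityMeasure (μ.map (X 0)) :=
    Measure.isProbabilityMeasure_map (hX 0).aemeasurable
  have hpow : Measurable fun x : ℝ => ENNReal.ofReal (|x| ^ q) := by fun_prop
  have hle : ∀ i j, i ≤ j → ∫⁻ ω, ENNReal.ofReal (|h (X i ω) (X j ω)| ^ q) ∂μ ≤
      ENNReal.ofReal M := by
    intro i j hij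
    obtain ⟨k, rfl⟩ := Nat.exists_eq_add_of_le hij
    have e := hs.map_pair_eq hX i k
    have l := fun i j => lintegral_map (μ := μ) (g := fun ω => (X i ω, X j ω))
      (f := fun p : ℝ × ℝ => ENNReal.ofReal (|h p.1 p.2| ^ q)) (hpow.comp hh)
      ((hX i).prodMk (hX j))
    rw [← l i (i + k), e, l]
    exact hM₂ k
  have hpair : ∫⁻ ω, ENNReal.ofReal (|h (X i ω) (X j ω)| ^ q) ∂μ ≤ ENNReal.ofReal M := by
    rcases le_total i j with hij | hij
    · exact hle i j hij
    · simp_rw [hsym (X i _)]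
      exact hle j i hij
  have hXij := (hX i).prodMk (hX j)
  have : IsProbabilityMeasure (μ.map fun ω => (X i ω, X j ω)) :=
    Measure.isProbabilityMeasure_map hXij.aemeasurable
  have := lintegral_hoeff2_le (P := μ.map fun ω => (X i ω, X j ω)) hh hq
    (by rw [Measure.map_map measurable_fst hXij]; exact hs.map_eq hX i)
    (by rw [Measure.map_map measurable_snd hXij]; exact hs.map_eq hX j) hM₁
    (by
      rw [lintegral_map (f := fun p : ℝ × ℝ => ENNReal.ofReal (|h p.1 p.2| ^ q))
        (hpow.comp hh) hXij]
      exact hpair)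
  rwa [lintegral_map (f := fun p : ℝ × ℝ =>
    ENNReal.ofReal (|hoeff2 (μ.map (X 0)) h p.1 p.2| ^ q)) (hpow.comp (measurable_hoeff2 hh))
    hXij] at this

/-- The covariance inequality when `X v` is separated from the other three variables by the
σ-algebra `m`. -/
lemma abs_integral_hoeff2_mul_le_of_separated (hm : m ≤ mΩ) {X : ℕ → Ω → ℝ} {μ : Measure Ω}
    [IsProbabilityMeasure μ] (hX : ∀ n, Measurable (X n)) (hs : IsStationary X μ) {h : ℝ → ℝ → ℝ}
    {γ N δ M L : ℝ} (hγ : 0 < γ) (hδ : 0 < δ) (hM : 0 < M) (hL : IsPLipschitz X μ h L)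
    (hh : Measurable (fun p : ℝ × ℝ => h p.1 p.2)) (hsym : ∀ x y, h x y = h y x)
    (hXγ : Integrable (fun ω => |X 0 ω| ^ γ) μ)
    (hN : (∫ ω, |X 0 ω| ^ γ ∂μ) ^ (1 / γ) = N)
    (hM₁ : ∫⁻ p : ℝ × ℝ, ENNReal.ofReal (|h p.1 p.2| ^ (2 + δ))
      ∂((μ.map (X 0)).prod (μ.map (X 0))) ≤ ENNReal.ofReal M)
    (hM₂ : ∀ k : ℕ, ∫⁻ ω, ENNReal.ofReal (|h (X 0 ω) (X k ω)| ^ (2 + δ)) ∂μ ≤ ENNReal.ofReal M)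
    {v y b c : ℕ} (hy : Measurable[m] (X y)) (hb : Measurable[m] (X b))
    (hc : Measurable[m] (X c)) {α : ℝ} (hα1 : α ≤ 1)
    (hα : ∀ A : Set ℝ, MeasurableSet A → ∀ B, MeasurableSet[m] B →
      |μ.real (X v ⁻¹' A ∩ B) - μ.real (X v ⁻¹' A) * μ.real B| ≤ α) :
    |∫ ω, hoeff2 (μ.map (X 0)) h (X v ω) (X y ω) * hoeff2 (μ.map (X 0)) h (X b ω) (X c ω) ∂μ| ≤
      covConst γ N δ M L * α ^ (2 * γ * δ / (3 * γ * δ + δ + 5 * γ + 2)) := by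
  have hFp : IsProbabilityMeasure (μ.map (X 0)) :=
    Measure.isProbabilityMeasure_map (hX 0).aemeasurable
  have hpow : Measurable fun x : ℝ => |x| ^ γ := by fun_prop
  have hFγ : Integrable (fun x => |x| ^ γ) (μ.map (X 0)) :=
    (integrable_map_measure hpow.aestronglyMeasurable (hX 0).aemeasurable).2 hXγ
  have hFN : ∫ x, |x| ^ γ ∂(μ.map (X 0)) = N ^ γ := by
    rw [integral_map (hX 0).aemeasurable hpow.aestronglyMeasurable, ← hN, ← Real.rpow_mul
      (integral_nonneg fun ω => by positivity), one_div_mul_cancel hγ.ne', Real.rpow_one]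
  have hhi := integrable_of_lintegral_rpow_le hh (by linarith) hM₁
  have hmom := lintegral_hoeff2_pair_le hX hs hh hsym (by linarith) hM₁ hM₂
  have hmF := lintegral_hoeff2_le (P := (μ.map (X 0)).prod (μ.map (X 0))) hh (by linarith)
    Measure.fst_prod Measure.snd_prod hM₁ hM₁
  have hG : Measurable[m] fun ω => hoeff2 (μ.map (X 0)) h (X b ω) (X c ω) :=
    (measurable_hoeff2 hh).comp (hb.prodMk hc)
  have hpair : μ.map (fun ω => (X v ω, X y ω)) ∈ pairLaws X μ ∨
      μ.map (fun ω => (X y ω, X v ω)) ∈ pairLaws X μ :=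
    (le_total v y).imp (map_pair_mem_pairLaws hX hs) (map_pair_mem_pairLaws hX hs)
  set D := 3 * γ * δ + δ + 5 * γ + 2 with hD
  have hD0 : 0 < D := by positivity
  set I := ∫ ω, hoeff2 (μ.map (X 0)) h (X v ω) (X y ω) *
    hoeff2 (μ.map (X 0)) h (X b ω) (X c ω) ∂μ
  -- The scale must be positive, so the bound is first proved for every positive upper bound `a ≤ 1`
  -- of `α`.
  have key : ∀ a : ℝ, 0 < a → a ≤ 1 → α ≤ a →
      |I| ≤ covConst γ N δ M L * a ^ (2 * γ * δ / D) := by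
    intro a ha ha1 hαa
    -- The inverse of the relation `a = β ^ (D / (2 * γ))` required by `exists_discretization`; the
    -- claimed rate is then `β ^ δ`.
    set β := a ^ (2 * γ / D) with hβ
    have hβ0 : 0 < β := by positivity
    have hβ1 : β ≤ 1 := Real.rpow_le_one ha.le ha1 (by positivity)
    have hβa : β ^ (D / (2 * γ)) = a := by
      rw [hβ, ← Real.rpow_mul ha.le]
      rw [show 2 * γ / D * (D / (2 * γ)) = 1 by field_simp, Real.rpow_one]
    have hβδ : a ^ (2 * γ * δ / D) = β ^ δ := by
      rw [hβ, ← Real.rpow_mul ha.le]; congr 1; ring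
    obtain ⟨J, hJ⟩ := exists_discretization hγ hδ hFγ hβ0 hβ1
    rw [hβa, hFN] at hJ
    have hbound := abs_integral_hoeff2_mul_le hm hX hs hL hh hsym rfl hhi (hX v) hy hG
      (hs.map_eq hX v) (hs.map_eq hX y) hpair hδ (by positivity) (hmom v y) (hmom b c) hmF
      (fun A hA B hB => (hα A hA B hB).trans hαa) (by positivity : 0 < β ^ (1 + δ)) J
      (A := β ^ (-2 : ℝ)) (K := β ^ (-1 : ℝ)) (by positivity) (by positivity) hJ
    refine hbound.trans_eq ?_
    have e₁ : β ^ (-2 : ℝ) * (2 * ((N ^ γ + 64 / 3) * β ^ (2 + δ))) =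
        2 * (N ^ γ + 64 / 3) * β ^ δ := by
      have : β ^ δ = β ^ (-2 : ℝ) * β ^ (2 + δ) := by rw [← Real.rpow_add hβ0]; ring_nf
      rw [this]; ring
    have e₂ : (β ^ (-2 : ℝ)) ^ (-(δ / 2)) = β ^ δ := by
      rw [← Real.rpow_mul hβ0.le]; congr 1; ring
    have e₃ : β ^ (-1 : ℝ) * (4 * (L * β ^ (1 + δ))) = 4 * L * β ^ δ := by
      have : β ^ δ = β ^ (-1 : ℝ) * β ^ (1 + δ) := by rw [← Real.rpow_add hβ0]; ring_nf
      rw [this]; ring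
    have e₄ : (β ^ (-1 : ℝ)) ^ (-δ) = β ^ δ := by
      rw [← Real.rpow_mul hβ0.le]; congr 1; ring
    rw [e₁, e₂, e₃, e₄, hβδ, covConst]
    ring
  have hα0 : 0 ≤ α := (abs_nonneg _).trans (hα ∅ MeasurableSet.empty ∅ (@MeasurableSet.empty _ m))
  rcases hα0.eq_or_lt with h0 | hpos
  -- For `α = 0` the bound is obtained by letting `a` decrease to zero.
  · have hp : 0 < 2 * γ * δ / D := by positivity
    have hlim : Filter.Tendsto (fun a : ℝ => covConst γ N δ M L * a ^ (2 * γ * δ / D))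
        (nhdsWithin 0 (Set.Ioi 0)) (nhds (covConst γ N δ M L * 0 ^ (2 * γ * δ / D))) :=
      ((Real.continuousAt_rpow_const 0 _ (Or.inr hp.le)).tendsto.const_mul _).mono_left
        nhdsWithin_le_nhds
    rw [← h0]
    refine ge_of_tendsto hlim ?_
    filter_upwards [Ioo_mem_nhdsGT (zero_lt_one' ℝ)] with a ha
    exact key a ha.1 ha.2.le (by rw [← h0]; exact ha.1.le)
  · exact key α hpos hα1 le_rfl

end Cov

/-! ### Separation of one index and the final assembly. -/

/-- One of the four variables is separated from the other three by the larger outer gap. -/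
lemma exists_separated_index (i : Fin 4 → ℕ) :
    ∃ p : Fin 4, (∀ j, j ≠ p → i p + outerGap i ≤ i j) ∨
      ∃ k, k + outerGap i ≤ i p ∧ ∀ j, j ≠ p → i j ≤ k := by
  set σ := Tuple.sort i with hσ
  have hmono : Monotone (i ∘ σ) := Tuple.monotone_sort i
  have hsymm : ∀ j, i j = (i ∘ σ) (σ.symm j) := fun j => by simp
  have h01 := hmono (show (0 : Fin 4) ≤ 1 by decide)
  have h23 := hmono (show (2 : Fin 4) ≤ 3 by decide)
  rcases le_total ((i ∘ σ) 3 - (i ∘ σ) 2) ((i ∘ σ) 1 - (i ∘ σ) 0) with hg | hg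
  · refine ⟨σ 0, Or.inl fun j hj => ?_⟩
    have hj' : (1 : Fin 4) ≤ σ.symm j :=
      Fin.one_le_of_ne_zero fun h => hj (by rw [← h]; simp)
    have h1 := hmono hj'
    rw [hsymm j, outerGap, max_eq_left hg]
    change (i ∘ σ) 0 + _ ≤ _
    omega
  · refine ⟨σ 3, Or.inr ⟨(i ∘ σ) 2, ?_, fun j hj => ?_⟩⟩
    · rw [outerGap, max_eq_right hg]
      change _ ≤ (i ∘ σ) 3
      omega
    · have hne : σ.symm j ≠ 3 := fun h => hj (by rw [← h]; simp)
      rw [hsymm j]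
      exact hmono (by omega)

end UStat

end

theorem mainTheorem2 (γ N δ M L : ℝ) (hγ : 0 < γ) (hδ : 0 < δ) (hM : 0 < M) :
    ∃ K : ℝ, ∀ (Ω : Type*) [MeasurableSpace Ω] (μ : Measure Ω) [IsProbabilityMeasure μ]
      (X : ℕ → Ω → ℝ) (h : ℝ → ℝ → ℝ),
      (∀ n, Measurable (X n)) →
      UStat.IsStationary X μ →
      Measurable (fun p : ℝ × ℝ => h p.1 p.2) →
      (∀ x y, h x y = h y x) →
      UStat.IsPLipschitz X μ h L →
      Integrable (fun ω => |X 0 ω| ^ γ) μ →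
      (∫ ω, |X 0 ω| ^ γ ∂μ) ^ (1 / γ) = N →
      (∫⁻ p : ℝ × ℝ, ENNReal.ofReal (|h p.1 p.2| ^ (2 + δ))
          ∂((μ.map (X 0)).prod (μ.map (X 0))) ≤ ENNReal.ofReal M) →
      (∀ k : ℕ, ∫⁻ ω, ENNReal.ofReal (|h (X 0 ω) (X k ω)| ^ (2 + δ)) ∂μ ≤ ENNReal.ofReal M) →
      ∀ i : Fin 4 → ℕ,
        Integrable (fun ω => UStat.hoeff2 (μ.map (X 0)) h (X (i 0) ω) (X (i 1) ω) *
          UStat.hoeff2 (μ.map (X 0)) h (X (i 2) ω) (X (i 3) ω)) μ ∧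
        |∫ ω, UStat.hoeff2 (μ.map (X 0)) h (X (i 0) ω) (X (i 1) ω) *
          UStat.hoeff2 (μ.map (X 0)) h (X (i 2) ω) (X (i 3) ω) ∂μ| ≤
          K * UStat.alphaMix X μ (UStat.outerGap i) ^
            (2 * γ * δ / (3 * γ * δ + δ + 5 * γ + 2)) := by
  refine ⟨UStat.covConst γ N δ M L, ?_⟩
  intro Ω _ μ _ X h hX hs hh hsym hL hXγ hN hM₁ hM₂ i
  have hFp : IsProbabilityMeasure (μ.map (X 0)) :=
    Measure.isProbabilityMeasure_map (hX 0).aemeasurable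
  have hmeas : ∀ j k, Measurable fun ω => UStat.hoeff2 (μ.map (X 0)) h (X j ω) (X k ω) :=
    fun j k => (UStat.measurable_hoeff2 hh).comp ((hX j).prodMk (hX k))
  have hmom := UStat.lintegral_hoeff2_pair_le hX hs hh hsym (by linarith) hM₁ hM₂
  refine ⟨UStat.integrable_of_lintegral_rpow_le ((hmeas _ _).mul (hmeas _ _)) (by linarith)
    (UStat.lintegral_mul_rpow_le (hmeas _ _) hδ (by positivity) (hmom _ _) (hmom _ _)), ?_⟩
  have hsym₂ : ∀ x y, UStat.hoeff2 (μ.map (X 0)) h x y = UStat.hoeff2 (μ.map (X 0)) h y x :=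
    fun x y => by simp only [UStat.hoeff2, hsym x y]; ring
  obtain ⟨p, hp⟩ := UStat.exists_separated_index i
  have key : ∀ y b c : Fin 4, y ≠ p → b ≠ p → c ≠ p →
      |∫ ω, UStat.hoeff2 (μ.map (X 0)) h (X (i p) ω) (X (i y) ω) *
        UStat.hoeff2 (μ.map (X 0)) h (X (i b) ω) (X (i c) ω) ∂μ| ≤
        UStat.covConst γ N δ M L * UStat.alphaMix X μ (UStat.outerGap i) ^
          (2 * γ * δ / (3 * γ * δ + δ + 5 * γ + 2)) := by
    intro y b c hy hb hc
    -- The isolated variable is either the earliest, with `m` the future of the gap, or the latest,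
    -- with `m` the past; the mixing bound is swapped in the second case.
    rcases hp with hp | ⟨k, hk, hp⟩
    · refine UStat.abs_integral_hoeff2_mul_le_of_separated
        (UStat.sigmaGen_le hX (Set.Ici (i p + UStat.outerGap i))) hX hs hγ hδ hM hL hh hsym hXγ hN
        hM₁ hM₂ (UStat.measurable_sigmaGen (hp y hy)) (UStat.measurable_sigmaGen (hp b hb))
        (UStat.measurable_sigmaGen (hp c hc)) (UStat.alphaMix_le_one X _) fun A hA B hB => ?_
      exact UStat.abs_sub_le_alphaMix X (i p) _ (UStat.measurable_sigmaGen Set.self_mem_Iic hA) hB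
    · refine UStat.abs_integral_hoeff2_mul_le_of_separated
        (UStat.sigmaGen_le hX (Set.Iic k)) hX hs hγ hδ hM hL hh hsym hXγ hN
        hM₁ hM₂ (UStat.measurable_sigmaGen (hp y hy)) (UStat.measurable_sigmaGen (hp b hb))
        (UStat.measurable_sigmaGen (hp c hc)) (UStat.alphaMix_le_one X _) fun A hA B hB => ?_
      have := UStat.abs_sub_le_alphaMix (μ := μ) X k (UStat.outerGap i) hB
        (UStat.measurable_sigmaGen (I := Set.Ici (k + UStat.outerGap i)) hk hA)
      rwa [Set.inter_comm, mul_comm] at this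
  -- Symmetry of `hoeff2` and commutativity of the product bring the isolated variable to the first
  -- place.
  fin_cases p
  · exact key 1 2 3 (by decide) (by decide) (by decide)
  · have := key 0 2 3 (by decide) (by decide) (by decide)
    simp_rw [hsym₂ (X (i 0) _)]
    exact this
  · have := key 3 0 1 (by decide) (by decide) (by decide)
    simp_rw [mul_comm (UStat.hoeff2 (μ.map (X 0)) h (X (i 0) _) _)]
    exact this
  · have := key 2 0 1 (by decide) (by decide) (by decide)
    simp_rw [mul_comm (UStat.hoeff2 (μ.map (X 0)) h (X (i 0) _) _), hsym₂ (X (i 2) _)]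
    exact this
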